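/- Let $\theta>0$ and let $n_1,n_2,\ldots$ be integers with $n_i\ge 1$; put $N_t=n_1+\cdots+n_t$ ($N_0=0$), and let $M(n_1,\ldots,n_t)$ be the multiset with $n_i$ copies of $i$ for $1\le i\le t$. By a theorem of Knuth every permutation $\pi$ of $M(n_1,\ldots,n_t)$ is represented uniquely as an intercalation product of cycles $(x_{1,1}\ldots x_{1,m_1}\,y_1)\perp\cdots\perp(x_{r,1}\ldots x_{r,m_r}\,y_r)$ with $y_1\le\cdots\le y_r$ and $y_i<x_{i,j}$ for all $i,j$; $|\pi|=r$ is the number of cycles of $\pi$. The multiset Chinese restaurant process is the Markov chain $(\tilde\Pi_t)_{t\ge0}$, with $\tilde\Pi_t$ a permutation of $M(n_1,\ldots,n_t)$ in this representation and $\tilde\Pi_0=\emptyset$, which moves from time $t-1$ to time $t$ as follows: for some $0\le k\le n_t$, $k$ of the copies of $t$ form $k$ new singleton cycles $(t)$, and the other $n_t-k$ copies are inserted immediately to the left of entries of the cycles of $\tilde\Pi_{t-1}$ (any number of copies at each entry); each such way has probability $\theta^{k}/F_t(\theta)$, where $$F_t(\theta)=\sum_{k=0}^{n_t}\binom{N_{t-1}-1+n_t-k}{n_t-k}\theta^{k},\qquad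 \binom{-1}{0}=1 .$$ Let $K_t=|\tilde\Pi_t|$. If $\theta=1$ and $n_i=n\ge 1$ for all $i\ge1$, then ${\mathbb E}(K_t)/\log t\to1$ and ${\rm Var}(K_t)/\log t\to 1$ as $t\to\infty$. For every $\theta>0$, if the sequence $n_i\geq 1$ is bounded, then there are constants $C_1,C_2>0$ with $C_1\log t\le {\mathbb E}(K_t)\le C_2\log t$ for all $t\ge2$, and likewise (with possibly other constants) for ${\rm Var}(K_t)$; moreover $K_t/{\mathbb E}(K_t)\to1$ almost surely, and $(K_t-{\mathbb E}(K_t))/\sqrt{{\rm Var}(K_t)}$ converges in distribution to ${\rm N}(0,1)$ as $t\to\infty$. -/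

import Mathlib

open MeasureTheory ProbabilityTheory Filter Topology

namespace MultisetCRP

/-- `N_t = n_1 + ⋯ + n_t`. (The value `n 0` is never used.) -/
def totalSize (n : ℕ → ℕ) (t : ℕ) : ℕ := ∑ i ∈ Finset.Icc 1 t, n i

/-- The multiset `M(n_1, …, n_t)`, with `n_i` copies of `i` for `1 ≤ i ≤ t`. -/
def baseMultiset (n : ℕ → ℕ) (t : ℕ) : Multiset ℕ :=
  ∑ i ∈ Finset.Icc 1 t, Multiset.replicate (n i) i

/-- A cycle `(x_1 … x_m y)` of a multiset permutation, with its last entry `y` kept apart. -/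
@[ext]
structure MCycle where
  xs : List ℕ
  y : ℕ

/-- The word `x_1 … x_m y` of a cycle. -/
def MCycle.word (c : MCycle) : List ℕ := c.xs ++ [c.y]

/-- A permutation of `M(n_1, …, n_t)`, represented by its unique factorisation as an
intercalation product of cycles `(x_{i,1} … x_{i,m_i} y_i)` with `y_1 ≤ y_2 ≤ ⋯`
and `y_i < x_{i,j}`. -/
@[ext]
structure MultisetPerm (n : ℕ → ℕ) (t : ℕ) where
  /-- The factors, in order. -/
  cycles : List MCycle
  content : (cycles.map fun c => (c.word : Multiset ℕ)).sum = baseMultiset n t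
  sorted : cycles.Pairwise fun c d => c.y ≤ d.y
  last_lt : ∀ c ∈ cycles, ∀ x ∈ c.xs, c.y < x

instance (n : ℕ → ℕ) (t : ℕ) : MeasurableSpace (MultisetPerm n t) := ⊤

/-- `|π|`, the number of cycles of the multiset permutation `π`. -/
def MultisetPerm.numCycles {n : ℕ → ℕ} {t : ℕ} (π : MultisetPerm n t) : ℕ := π.cycles.length

/-- The places of a list of cycles: `⟨i, j⟩` is the place of the `j`-th entry of the word of the
`i`-th cycle (so `j = (xs).length` is the place of `y`). -/
abbrev Place (l : List MCycle) : Type := (i : Fin l.length) × Fin ((l.get i).xs.length + 1)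

/-- Insert, for each `j`, `m j` copies of `u` immediately to the left of the `j`-th entry of the
cycle `c`. -/
def MCycle.insertLeft (u : ℕ) (c : MCycle) (m : Fin (c.xs.length + 1) → ℕ) : MCycle where
  xs := (List.ofFn fun j : Fin c.xs.length =>
      List.replicate (m j.castSucc) u ++ [c.xs.get j]).flatten ++
    List.replicate (m (Fin.last _)) u
  y := c.y

/-- Insert copies of `u` immediately to the left of the entries of `l`, at each place as many
copies as the multiset `s` of places says, and append `k` new singleton cycles `(u)`. -/
def insertCopies (u : ℕ) (l : List MCycle) (k : ℕ) (s : Multiset (Place l)) : List MCycle :=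
  (List.ofFn fun i : Fin l.length =>
      (l.get i).insertLeft u fun j => s.count (⟨i, j⟩ : Place l)) ++
    List.replicate k ⟨[], u⟩

theorem coe_word_insertLeft (u : ℕ) (c : MCycle) (m : Fin (c.xs.length + 1) → ℕ) :
    ((c.insertLeft u m).word : Multiset ℕ) =
      (c.word : Multiset ℕ) + Multiset.replicate (∑ j, m j) u := by
  have key : ∀ (l : List ℕ) (f : Fin l.length → ℕ),
      (((List.ofFn fun j : Fin l.length => List.replicate (f j) u ++ [l.get j]).flatten :
        List ℕ) : Multiset ℕ) = (l : Multiset ℕ) + Multiset.replicate (∑ j, f j) u := by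
    intro l
    induction l with
    | nil => intro f; simp
    | cons a l ih =>
      intro f
      have h := ih fun j => f j.succ
      simp only [List.length_cons, List.ofFn_succ, List.flatten_cons, Fin.sum_univ_succ,
        List.get_cons_zero]
      rw [← Multiset.coe_add]
      refine (congrArg _ h).trans ?_
      rw [← Multiset.coe_add, Multiset.coe_replicate, Multiset.replicate_add,
        show ((a :: l : List ℕ) : Multiset ℕ) = ([a] : List ℕ) + (l : Multiset ℕ) from rfl]
      abel
  have h := key c.xs fun j => m j.castSucc
  simp only [MCycle.word, MCycle.insertLeft, ← Multiset.coe_add]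
  rw [h, Fin.sum_univ_castSucc, Multiset.replicate_add, Multiset.coe_replicate]
  abel

theorem mem_xs_insertLeft {u : ℕ} {c : MCycle} {m : Fin (c.xs.length + 1) → ℕ} {x : ℕ}
    (h : x ∈ (c.insertLeft u m).xs) : x ∈ c.xs ∨ x = u := by
  simp only [MCycle.insertLeft, List.mem_append, List.mem_flatten, List.mem_ofFn,
    List.mem_replicate] at h
  rcases h with ⟨w, ⟨j, rfl⟩, hx⟩ | ⟨_, rfl⟩
  · simp only [List.mem_append, List.mem_replicate, List.mem_singleton] at hx
    rcases hx with ⟨_, rfl⟩ | rfl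
    · exact Or.inr rfl
    · exact Or.inl (List.get_mem _ _)
  · exact Or.inr rfl

theorem content_insertCopies (u : ℕ) (l : List MCycle) (k : ℕ) (s : Multiset (Place l)) :
    ((insertCopies u l k s).map fun c => (c.word : Multiset ℕ)).sum =
      (l.map fun c => (c.word : Multiset ℕ)).sum + Multiset.replicate (s.card + k) u := by
  have h1 : (l.map fun c => (c.word : Multiset ℕ)).sum =
      ∑ i : Fin l.length, ((l.get i).word : Multiset ℕ) := by
    rw [← List.sum_ofFn]
    congr 1
    conv_lhs => rw [← List.ofFn_get l, List.map_ofFn]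
    rfl
  have h2 : (∑ i : Fin l.length, ∑ j, s.count (⟨i, j⟩ : Place l)) = s.card := by
    rw [← Fintype.sum_sigma' (fun (i : Fin l.length) j => s.count (⟨i, j⟩ : Place l))]
    exact Multiset.sum_count_eq_card fun a _ => Finset.mem_univ a
  have h3 : ∀ (f : Fin l.length → ℕ), ∑ i, Multiset.replicate (f i) u =
      Multiset.replicate (∑ i, f i) u := fun f =>
    (map_sum (Multiset.replicateAddMonoidHom u) f Finset.univ).symm
  have h4 : (List.map (fun c : MCycle => (c.word : Multiset ℕ))
      (List.replicate k ⟨[], u⟩)).sum = Multiset.replicate k u := by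
    rw [List.map_replicate, List.sum_replicate]
    simp [MCycle.word, Multiset.nsmul_singleton]
  rw [insertCopies, List.map_append, List.sum_append, h4, List.map_ofFn, List.sum_ofFn, h1]
  simp only [Function.comp_apply, coe_word_insertLeft, Finset.sum_add_distrib]
  rw [h3, h2, Multiset.replicate_add, add_assoc]

theorem MultisetPerm.mem_le {n : ℕ → ℕ} {t : ℕ} (π : MultisetPerm n t) {c : MCycle}
    (hc : c ∈ π.cycles) : c.y ≤ t := by
  have h1 : c.y ∈ (π.cycles.map fun c => (c.word : Multiset ℕ)).sum := by
    have h := List.single_le_sum (l := π.cycles.map fun c => (c.word : Multiset ℕ))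
      (fun _ _ => Multiset.zero_le _) _ (List.mem_map_of_mem hc)
    exact Multiset.mem_of_le h (by simp [MCycle.word])
  rw [π.content, baseMultiset, Multiset.mem_sum] at h1
  obtain ⟨i, hi, h⟩ := h1
  rw [Multiset.eq_of_mem_replicate h]
  exact (Finset.mem_Icc.1 hi).2

/-- The extension of a permutation of `M(n_1, …, n_t)` to one of `M(n_1, …, n_{t+1})` in which
`k` of the `n_{t+1}` copies of `t + 1` form new singleton cycles and the others are inserted to
the left of existing entries, as prescribed by the multiset `s` of places. -/
def MultisetPerm.extend {n : ℕ → ℕ} {t : ℕ} (π : MultisetPerm n t) (k : Fin (n (t + 1) + 1))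
    (s : Sym (Place π.cycles) (n (t + 1) - k)) : MultisetPerm n (t + 1) where
  cycles := insertCopies (t + 1) π.cycles k s
  content := by
    rw [content_insertCopies, π.content, baseMultiset, baseMultiset,
      Finset.sum_Icc_succ_top (by omega)]
    congr 2
    have h : Multiset.card (s : Multiset (Place π.cycles)) = n (t + 1) - k := s.2
    rw [h]
    omega
  sorted := by
    rw [insertCopies, List.pairwise_append]
    refine ⟨?_, ?_, ?_⟩
    · rw [List.pairwise_ofFn]
      intro i j hij
      exact List.pairwise_iff_get.1 π.sorted i j hij
    · exact List.pairwise_replicate.2 (Or.inr le_rfl)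
    · intro a ha b hb
      obtain ⟨i, rfl⟩ := List.mem_ofFn.1 ha
      rw [(List.mem_replicate.1 hb).2]
      exact (π.mem_le (c := π.cycles.get i) (List.get_mem _ i)).trans (Nat.le_succ t)
  last_lt := by
    intro c hc x hx
    rcases List.mem_append.1 hc with hc | hc
    · obtain ⟨i, rfl⟩ := List.mem_ofFn.1 hc
      rcases mem_xs_insertLeft hx with h | rfl
      · exact π.last_lt _ (List.get_mem _ i) _ h
      · exact Nat.lt_succ_of_le (π.mem_le (c := π.cycles.get i) (List.get_mem _ i))
    · rw [(List.mem_replicate.1 hc).2] at hx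
      simp at hx

/-- `F_t(θ) = ∑_{k=0}^{n_t} binom(N_{t-1} - 1 + n_t - k, n_t - k) θ^k`, here at `t + 1` in place
of `t`; `Nat.multichoose a b` is `binom(a + b - 1, b)`, with value `1` at `a = b = 0`. -/
def normalizer (θ : ℝ) (n : ℕ → ℕ) (t : ℕ) : ℝ :=
  ∑ k ∈ Finset.range (n (t + 1) + 1),
    (Nat.multichoose (totalSize n t) (n (t + 1) - k) : ℝ) * θ ^ k

open Classical in
/-- The transition probability of the multiset Chinese restaurant process from `π` at time `t`
to `π'` at time `t + 1`: each way of extending `π` that creates `k` new cycles is taken with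
probability `θ ^ k / F_{t+1}(θ)`. -/
noncomputable def transitionProb (θ : ℝ) {n : ℕ → ℕ} {t : ℕ} (π : MultisetPerm n t)
    (π' : MultisetPerm n (t + 1)) : ℝ :=
  ∑ k : Fin (n (t + 1) + 1), ∑ s : Sym (Place π.cycles) (n (t + 1) - k),
    if π.extend k s = π' then θ ^ (k : ℕ) / normalizer θ n t else 0

/-- `X` is a multiset Chinese restaurant process with parameter `θ` and multiplicities `n_i`
under `P`: a Markov chain, started at the empty permutation (the only permutation of the empty
multiset) at time `0`, with the above transition probabilities. -/
structure IsCRP {Ω : Type*} [MeasurableSpace Ω] (P : Measure Ω) (θ : ℝ) (n : ℕ → ℕ)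
    (X : (t : ℕ) → Ω → MultisetPerm n t) : Prop where
  measurable : ∀ t, Measurable (X t)
  markov : ∀ (t : ℕ) (π : (s : ℕ) → MultisetPerm n s),
    P.real {ω | ∀ s ≤ t + 1, X s ω = π s} =
      P.real {ω | ∀ s ≤ t, X s ω = π s} * transitionProb θ (π t) (π (t + 1))

/-- `a_t ≍ b_t`. It is used with `b_t = log t`, which vanishes at `t = 1` (and `log 0` is not
defined), so the bounds are for `t ≥ 2`. -/
def SameOrder (a b : ℕ → ℝ) : Prop :=
  ∃ C₁ > 0, ∃ C₂ > 0, ∀ t ≥ 2, C₁ * b t ≤ a t ∧ a t ≤ C₂ * b t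

end MultisetCRP

/-!
Let `D_t` be the number of cycles born at step `t + 1`, and write `N = N_t`, `m = n_{t+1}`. The
weights `w_k` of `D_t = k` satisfy `(m - k) w_k θ = (N + m - k - 1) w_{k+1}`. Summing this identity
against test functions gives `E D_t = θ m / N + O(N⁻²)` and `E[D_t (D_t - 1)] = O(N⁻²)`, hence also
`Var D_t = θ m / N + O(N⁻²)`, for bounded `m`. Since `N` is of order `t`, mean and variance of
`K_t = D_0 + ⋯ + D_{t-1}` are comparable to the harmonic sums.

The law of `D_t` depends on the past only through the deterministic number `N_t` of places, so the
`D_t` are independent. They are bounded and the variance of their sum diverges, which gives the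
central limit theorem; and as the variance is at most a constant times the mean, `K_t / E K_t`
converges almost surely along the times at which `E K_t` passes `k²`, hence along all times.
-/

namespace MultisetCRP

section Asymptotics

open Asymptotics

theorem isLittleO_one_left_of_tendsto_atTop {α : Type*} {l : Filter α} {b : α → ℝ}
    (hb : Tendsto b l atTop) : (fun _ => (1 : ℝ)) =o[l] b :=
  (isLittleO_const_left_of_ne one_ne_zero).2 (tendsto_norm_atTop_atTop.comp hb)

theorem tendsto_div_of_sub_mul_isBigO_one {α : Type*} {l : Filter α} {a b : α → ℝ} {c : ℝ}
    (hb : Tendsto b l atTop) (h : (fun t => a t - c * b t) =O[l] fun _ => (1 : ℝ)) :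
    Tendsto (fun t => a t / b t) l (𝓝 c) := by
  have hlim := (h.trans_isLittleO
    (isLittleO_one_left_of_tendsto_atTop hb)).tendsto_div_nhds_zero.add_const c
  rw [zero_add] at hlim
  refine hlim.congr' ?_
  filter_upwards [hb.eventually_ne_atTop 0] with t ht
  field_simp
  ring

theorem tendsto_log_natCast_atTop : Tendsto (fun t : ℕ => Real.log t) atTop atTop :=
  Real.tendsto_log_atTop.comp tendsto_natCast_atTop_atTop

theorem tendsto_sum_range_inv_sub_log :
    Tendsto (fun t : ℕ => ∑ i ∈ Finset.range t, (i : ℝ)⁻¹ - Real.log t) atTop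
      (𝓝 Real.eulerMascheroniConstant) := by
  rw [← tendsto_add_atTop_iff_nat 1]
  simpa [Finset.sum_range_succ', harmonic] using Real.tendsto_harmonic_sub_log_add_one

theorem sum_range_inv_isEquivalent_log :
    (fun t : ℕ => ∑ i ∈ Finset.range t, (i : ℝ)⁻¹) ~[atTop] fun t : ℕ => Real.log t :=
  (tendsto_sum_range_inv_sub_log.isBigO_one ℝ).trans_isLittleO
    (isLittleO_one_left_of_tendsto_atTop tendsto_log_natCast_atTop)

theorem sum_range_sub_isBigO_one {u v : ℕ → ℝ}
    (h : (fun i => u i - v i) =O[atTop] fun i : ℕ => ((i : ℝ) ^ 2)⁻¹) :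
    (fun t => ∑ i ∈ Finset.range t, u i - ∑ i ∈ Finset.range t, v i) =O[atTop]
      fun _ => (1 : ℝ) := by
  simp_rw [← Finset.sum_sub_distrib]
  have hsum := summable_of_isBigO_nat (Real.summable_nat_pow_inv.2 one_lt_two) h
  exact hsum.hasSum.tendsto_sum_nat.isBigO_one ℝ

theorem tendsto_sum_range_div_log {u : ℕ → ℝ} {c : ℝ}
    (h : (fun i : ℕ => u i - c * (i : ℝ)⁻¹) =O[atTop] fun i : ℕ => ((i : ℝ) ^ 2)⁻¹) :
    Tendsto (fun t : ℕ => (∑ i ∈ Finset.range t, u i) / Real.log t) atTop (𝓝 c) := by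
  refine tendsto_div_of_sub_mul_isBigO_one tendsto_log_natCast_atTop ?_
  refine ((sum_range_sub_isBigO_one h).add
    ((tendsto_sum_range_inv_sub_log.isBigO_one ℝ).const_mul_left c)).congr_left fun t => ?_
  rw [← Finset.mul_sum]
  ring

theorem sum_range_isTheta_log {u v : ℕ → ℝ} {c C : ℝ}
    (h : (fun i => u i - v i) =O[atTop] fun i : ℕ => ((i : ℝ) ^ 2)⁻¹) (hc : 0 < c)
    (hcv : ∀ i : ℕ, c * (i : ℝ)⁻¹ ≤ v i) (hvC : ∀ i : ℕ, v i ≤ C * (i : ℝ)⁻¹) :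
    (fun t => ∑ i ∈ Finset.range t, u i) =Θ[atTop] fun t : ℕ => Real.log t := by
  have hv0 (i : ℕ) : 0 ≤ v i := le_trans (by positivity) (hcv i)
  have hinv (t : ℕ) : 0 ≤ ∑ i ∈ Finset.range t, (i : ℝ)⁻¹ :=
    Finset.sum_nonneg fun i _ => by positivity
  have hupper : (fun t => ∑ i ∈ Finset.range t, v i) =O[atTop]
      fun t => ∑ i ∈ Finset.range t, (i : ℝ)⁻¹ := by
    refine IsBigO.of_bound C (Eventually.of_forall fun t => ?_)
    rw [Real.norm_of_nonneg (Finset.sum_nonneg fun i _ => hv0 i), Real.norm_of_nonneg (hinv t),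
      Finset.mul_sum]
    exact Finset.sum_le_sum fun i _ => hvC i
  have hlower : (fun t => ∑ i ∈ Finset.range t, (i : ℝ)⁻¹) =O[atTop]
      fun t => ∑ i ∈ Finset.range t, v i := by
    refine IsBigO.of_bound c⁻¹ (Eventually.of_forall fun t => ?_)
    rw [Real.norm_of_nonneg (Finset.sum_nonneg fun i _ => hv0 i), Real.norm_of_nonneg (hinv t),
      le_inv_mul_iff₀ hc, Finset.mul_sum]
    exact Finset.sum_le_sum fun i _ => hcv i
  have hv : (fun t => ∑ i ∈ Finset.range t, v i) =Θ[atTop] fun t : ℕ => Real.log t :=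
    IsTheta.trans ⟨hupper, hlower⟩ sum_range_inv_isEquivalent_log.isTheta
  simpa only [Pi.add_def, add_sub_cancel] using
    hv.add_isLittleO ((sum_range_sub_isBigO_one h).trans_isLittleO
      (isLittleO_one_left_of_tendsto_atTop tendsto_log_natCast_atTop))

theorem exists_pos_forall_le_mul_of_isBigO {a b : ℕ → ℝ} {m : ℕ} (hb : ∀ t ≥ m, 0 < b t)
    (h : a =O[atTop] b) : ∃ C > 0, ∀ t ≥ m, a t ≤ C * b t := by
  have hshift := h.comp_tendsto (tendsto_add_atTop_nat m)
  obtain ⟨C, hC⟩ :=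
    (isBigO_nat_atTop_iff fun t ht => absurd ht (hb (t + m) (by omega)).ne').1 hshift
  refine ⟨max C 1, by positivity, fun t ht => ?_⟩
  have hle := hC (t - m)
  simp only [Function.comp_apply, Nat.sub_add_cancel ht, Real.norm_of_nonneg (hb t ht).le] at hle
  calc a t ≤ C * b t := (Real.le_norm_self _).trans hle
    _ ≤ max C 1 * b t := mul_le_mul_of_nonneg_right (le_max_left _ _) (hb t ht).le

theorem sameOrder_of_isTheta {a b : ℕ → ℝ} (ha : ∀ t ≥ 2, 0 < a t) (hb : ∀ t ≥ 2, 0 < b t)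
    (h : a =Θ[atTop] b) : SameOrder a b := by
  obtain ⟨C₁, hC₁, hle₁⟩ := exists_pos_forall_le_mul_of_isBigO ha h.2
  obtain ⟨C₂, hC₂, hle₂⟩ := exists_pos_forall_le_mul_of_isBigO hb h.1
  refine ⟨C₁⁻¹, inv_pos.2 hC₁, C₂, hC₂, fun t ht => ⟨?_, hle₂ t ht⟩⟩
  rw [inv_mul_le_iff₀ hC₁]
  exact hle₁ t ht

theorem SameOrder.tendsto_atTop {a b : ℕ → ℝ} (h : SameOrder a b) (hb : Tendsto b atTop atTop) :
    Tendsto a atTop atTop := by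
  obtain ⟨C₁, hC₁, _, _, hle⟩ := h
  exact tendsto_atTop_mono' _ (eventually_atTop.2 ⟨2, fun t ht => (hle t ht).1⟩)
    (hb.const_mul_atTop hC₁)

end Asymptotics

section CentralLimit

theorem norm_prod_sub_prod_le {ι R : Type*} [NormedCommRing R] [NormOneClass R] {s : Finset ι}
    {f g : ι → R} (hf : ∀ i ∈ s, ‖f i‖ ≤ 1) (hg : ∀ i ∈ s, ‖g i‖ ≤ 1) :
    ‖∏ i ∈ s, f i - ∏ i ∈ s, g i‖ ≤ ∑ i ∈ s, ‖f i - g i‖ := by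
  induction s using Finset.cons_induction with
  | empty => simp
  | cons a s ha ih =>
    simp only [Finset.forall_mem_cons] at hf hg
    have hprod : ‖∏ i ∈ s, f i‖ ≤ 1 :=
      (Finset.norm_prod_le s f).trans (Finset.prod_le_one (fun i _ => norm_nonneg _) hf.2)
    rw [Finset.prod_cons, Finset.prod_cons, Finset.sum_cons]
    calc ‖f a * ∏ i ∈ s, f i - g a * ∏ i ∈ s, g i‖
        = ‖(f a - g a) * ∏ i ∈ s, f i + g a * (∏ i ∈ s, f i - ∏ i ∈ s, g i)‖ := by
          congr 1
          ring
      _ ≤ ‖f a - g a‖ * ‖∏ i ∈ s, f i‖ + ‖g a‖ * ‖∏ i ∈ s, f i - ∏ i ∈ s, g i‖ :=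
          (norm_add_le _ _).trans (add_le_add (norm_mul_le _ _) (norm_mul_le _ _))
      _ ≤ ‖f a - g a‖ * 1 + 1 * ∑ i ∈ s, ‖f i - g i‖ := by
          gcongr
          · exact hg.1
          · exact ih hf.2 hg.2
      _ = ‖f a - g a‖ + ∑ i ∈ s, ‖f i - g i‖ := by ring

theorem norm_exp_mul_I_sub_le {x : ℝ} (hx : |x| ≤ 1) :
    ‖Complex.exp (x * Complex.I) - (1 + x * Complex.I - (x ^ 2 / 2 : ℝ))‖ ≤ |x| ^ 3 := by
  have hnorm : ‖(x : ℂ) * Complex.I‖ = |x| := by simp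
  have hbound := Complex.exp_bound (x := x * Complex.I) (hnorm.trans_le hx) three_pos
  have hsum : ∑ j ∈ Finset.range 3, ((x : ℂ) * Complex.I) ^ j / (j.factorial : ℂ) =
      1 + x * Complex.I - (x ^ 2 / 2 : ℝ) := by
    simp [Finset.sum_range_succ, mul_pow, Nat.factorial]
    ring
  rw [hsum, hnorm] at hbound
  refine hbound.trans (mul_le_of_le_one_right (by positivity) ?_)
  norm_num [Nat.factorial]

variable {Ω : Type*} [MeasurableSpace Ω] {P : Measure Ω} {Y : Ω → ℝ} {C : ℝ}

theorem charFun_map_eq_integral_exp (hY : AEMeasurable Y P) (s : ℝ) :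
    charFun (P.map Y) s = ∫ ω, Complex.exp ((s * Y ω : ℝ) * Complex.I) ∂P := by
  rw [charFun_apply_real, integral_map hY (by fun_prop)]
  simp

theorem variance_sum_of_pairwise_indepFun {ι : Type*} {Y : ι → Ω → ℝ}
    (hindep : Pairwise fun i j => Y i ⟂ᵢ[P] Y j) (hY : ∀ i, MemLp (Y i) 2 P) (s : Finset ι) :
    Var[fun ω => ∑ i ∈ s, Y i ω; P] = ∑ i ∈ s, Var[Y i; P] := by
  rw [← IndepFun.variance_sum (fun i _ => hY i) fun i _ j _ hij => hindep hij]
  congr 1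
  ext ω
  simp

variable [IsProbabilityMeasure P]

theorem memLp_of_abs_le (hY : AEMeasurable Y P) (hC : ∀ᵐ ω ∂P, |Y ω| ≤ C) (p : ENNReal) :
    MemLp Y p P :=
  MemLp.of_bound hY.aestronglyMeasurable C hC

theorem norm_charFun_map_sub_le (hY : AEMeasurable Y P) (hC : ∀ᵐ ω ∂P, |Y ω| ≤ C)
    (hmean : P[Y] = 0) {s : ℝ} (hs : |s| * C ≤ 1) :
    ‖charFun (P.map Y) s - (1 - s ^ 2 * Var[Y; P] / 2 : ℝ)‖ ≤ |s| ^ 3 * C * Var[Y; P] := by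
  have hL2 := memLp_of_abs_le hY hC 2
  have hvar : Var[Y; P] = ∫ ω, Y ω ^ 2 ∂P := by simp [variance_eq_integral hY, hmean]
  have hI : Integrable (fun ω => ((s * Y ω : ℝ) : ℂ) * Complex.I) P :=
    ((hL2.integrable one_le_two).const_mul s).ofReal.mul_const _
  have hlin : Integrable (fun ω => 1 + ((s * Y ω : ℝ) : ℂ) * Complex.I) P :=
    (integrable_const _).add hI
  have hsq : Integrable (fun ω => (((s * Y ω) ^ 2 / 2 : ℝ) : ℂ)) P :=
    ((hL2.const_mul s).integrable_sq.div_const 2).ofReal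
  have hexp : Integrable (fun ω => Complex.exp ((s * Y ω : ℝ) * Complex.I)) P :=
    Integrable.of_bound (by fun_prop) 1 (ae_of_all _ fun ω => by
      rw [Complex.norm_exp_ofReal_mul_I])
  have hquad_int : Integrable
      (fun ω => 1 + (s * Y ω : ℝ) * Complex.I - ((s * Y ω) ^ 2 / 2 : ℝ)) P := hlin.sub hsq
  have hquad : ((1 - s ^ 2 * Var[Y; P] / 2 : ℝ) : ℂ) =
      ∫ ω, (1 + (s * Y ω : ℝ) * Complex.I - ((s * Y ω) ^ 2 / 2 : ℝ)) ∂P := by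
    rw [integral_sub hlin hsq, integral_add (integrable_const _) hI,
      integral_mul_const, integral_complex_ofReal, integral_complex_ofReal, integral_div,
      integral_const_mul, hmean, hvar]
    simp [mul_pow, integral_const_mul]
  rw [charFun_map_eq_integral_exp hY, hquad, ← integral_sub hexp hquad_int, hvar,
    ← integral_const_mul]
  refine norm_integral_le_of_norm_le (hL2.integrable_sq.const_mul _) ?_
  filter_upwards [hC] with ω hω
  have hsmall : |s * Y ω| ≤ 1 := by
    rw [abs_mul]
    exact (mul_le_mul_of_nonneg_left hω (abs_nonneg s)).trans hs
  calc _ ≤ |s * Y ω| ^ 3 := norm_exp_mul_I_sub_le hsmall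
    _ = |s| ^ 3 * |Y ω| * Y ω ^ 2 := by rw [abs_mul, ← sq_abs (Y ω)]; ring
    _ ≤ |s| ^ 3 * C * Y ω ^ 2 := by gcongr

theorem sq_mul_variance_le (hY : AEMeasurable Y P) (hC : ∀ᵐ ω ∂P, |Y ω| ≤ C) {s : ℝ}
    (hs : |s| * C ≤ 1) : s ^ 2 * Var[Y; P] ≤ |s| * C := by
  obtain ⟨ω, hω⟩ := hC.exists
  have hC0 : 0 ≤ C := (abs_nonneg _).trans hω
  have hvar : Var[Y; P] ≤ C ^ 2 := by
    have h := variance_le_sq_of_bounded (a := -C) (b := C) (hC.mono fun ω hω => abs_le.1 hω) hY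
    rwa [sub_neg_eq_add, add_self_div_two] at h
  calc s ^ 2 * Var[Y; P] ≤ s ^ 2 * C ^ 2 := by gcongr
    _ = (|s| * C) * (|s| * C) := by rw [← sq_abs s]; ring
    _ ≤ |s| * C := mul_le_of_le_one_left (by positivity) hs

theorem norm_charFun_map_sub_exp_le (hY : AEMeasurable Y P) (hC : ∀ᵐ ω ∂P, |Y ω| ≤ C)
    (hmean : P[Y] = 0) {s : ℝ} (hs : |s| * C ≤ 1) :
    ‖charFun (P.map Y) s - Real.exp (-(s ^ 2 * Var[Y; P] / 2))‖ ≤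
      2 * (|s| ^ 3 * C * Var[Y; P]) := by
  set v := Var[Y; P]
  have hsv : s ^ 2 * v ≤ |s| * C := sq_mul_variance_le hY hC hs
  have hsv0 : 0 ≤ s ^ 2 * v := mul_nonneg (sq_nonneg s) (variance_nonneg Y P)
  have hexp : |1 - s ^ 2 * v / 2 - Real.exp (-(s ^ 2 * v / 2))| ≤ |s| ^ 3 * C * v := by
    have htaylor := Real.abs_exp_sub_one_sub_id_le (x := -(s ^ 2 * v / 2))
      (by rw [abs_neg, abs_of_nonneg (by positivity)]; linarith)
    calc |1 - s ^ 2 * v / 2 - Real.exp (-(s ^ 2 * v / 2))|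
        = |Real.exp (-(s ^ 2 * v / 2)) - 1 - -(s ^ 2 * v / 2)| := by
          rw [← abs_neg]
          ring_nf
      _ ≤ (s ^ 2 * v) * (s ^ 2 * v) := by nlinarith
      _ ≤ (s ^ 2 * v) * (|s| * C) := by gcongr
      _ = |s| ^ 3 * C * v := by rw [← sq_abs s]; ring
  calc ‖charFun (P.map Y) s - Real.exp (-(s ^ 2 * v / 2))‖
      ≤ ‖charFun (P.map Y) s - (1 - s ^ 2 * v / 2 : ℝ)‖ +
          ‖((1 - s ^ 2 * v / 2 : ℝ) : ℂ) - Real.exp (-(s ^ 2 * v / 2))‖ :=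
        norm_sub_le_norm_sub_add_norm_sub _ _ _
    _ ≤ |s| ^ 3 * C * v + |s| ^ 3 * C * v := by
        refine add_le_add (norm_charFun_map_sub_le hY hC hmean hs) ?_
        rwa [← Complex.ofReal_sub, Complex.norm_real]
    _ = 2 * (|s| ^ 3 * C * v) := by ring

theorem norm_charFun_map_sum_sub_exp_le {ι : Type*} {Y : ι → Ω → ℝ} (hindep : iIndepFun Y P)
    (hY : ∀ i, AEMeasurable (Y i) P) (hC : ∀ i, ∀ᵐ ω ∂P, |Y i ω| ≤ C)
    (hmean : ∀ i, P[Y i] = 0) (s : Finset ι) {x : ℝ} (hx : |x| * C ≤ 1) :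
    ‖charFun (P.map fun ω => ∑ i ∈ s, Y i ω) x -
        Real.exp (-(x ^ 2 * Var[fun ω => ∑ i ∈ s, Y i ω; P] / 2))‖ ≤
      2 * (|x| ^ 3 * C * Var[fun ω => ∑ i ∈ s, Y i ω; P]) := by
  have hcharFun : charFun (P.map fun ω => ∑ i ∈ s, Y i ω) = ∏ i ∈ s, charFun (P.map (Y i)) :=
    (hindep.restrict _).charFun_map_fun_finsetSum_eq_prod fun i _ => hY i
  have hexp : (Real.exp (-(x ^ 2 * (∑ i ∈ s, Var[Y i; P]) / 2)) : ℂ) =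
      ∏ i ∈ s, (Real.exp (-(x ^ 2 * Var[Y i; P] / 2)) : ℂ) := by
    rw [← Complex.ofReal_prod, ← Real.exp_sum, Finset.sum_neg_distrib, ← Finset.sum_div,
      ← Finset.mul_sum]
  rw [variance_sum_of_pairwise_indepFun (fun i j hij => hindep.indepFun hij)
    (fun i => memLp_of_abs_le (hY i) (hC i) 2), hexp, hcharFun, Finset.prod_apply, Finset.mul_sum,
    Finset.mul_sum]
  refine (norm_prod_sub_prod_le (fun i _ => ?_) fun i _ => ?_).trans
    (Finset.sum_le_sum fun i _ => norm_charFun_map_sub_exp_le (hY i) (hC i) (hmean i) hx)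
  · have := Measure.isProbabilityMeasure_map (hY i)
    exact norm_charFun_le_one x
  · rw [Complex.norm_real, Real.norm_of_nonneg (Real.exp_nonneg _), Real.exp_le_one_iff,
      neg_nonpos]
    have := variance_nonneg (Y i) P
    positivity

theorem norm_charFun_map_standardized_sub_exp_le {ι : Type*} {Y : ι → Ω → ℝ}
    (hindep : iIndepFun Y P) (hY : ∀ i, AEMeasurable (Y i) P)
    (hC : ∀ i, ∀ᵐ ω ∂P, |Y i ω| ≤ C) (hmean : ∀ i, P[Y i] = 0) (s : Finset ι) {σ : ℝ}
    (hσ : 0 < σ) (hvar : Var[fun ω => ∑ i ∈ s, Y i ω; P] = σ ^ 2) {x : ℝ} (hx : |x| * C ≤ σ) :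
    ‖charFun (P.map fun ω => (∑ i ∈ s, Y i ω) / σ) x - Real.exp (-(x ^ 2 / 2))‖ ≤
      2 * |x| ^ 3 * C / σ := by
  have hscale : charFun (P.map fun ω => (∑ i ∈ s, Y i ω) / σ) x =
      charFun (P.map fun ω => ∑ i ∈ s, Y i ω) (σ⁻¹ * x) := by
    rw [← charFun_map_mul_comp (Finset.aemeasurable_fun_sum s fun i _ => hY i)]
    simp only [div_eq_inv_mul]
  have habs : |σ⁻¹ * x| = |x| / σ := by
    rw [abs_mul, abs_inv, abs_of_pos hσ, inv_mul_eq_div]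
  have hle := norm_charFun_map_sum_sub_exp_le hindep hY hC hmean s (x := σ⁻¹ * x) (by
    rw [habs, div_mul_eq_mul_div]
    exact div_le_one_of_le₀ hx hσ.le)
  rw [habs, hvar, ← hscale] at hle
  convert hle using 4
  · field_simp
  · field_simp

theorem tendstoInDistribution_standardized_sum {Y : ℕ → Ω → ℝ} (hindep : iIndepFun Y P)
    (hY : ∀ i, AEMeasurable (Y i) P) (hC : ∀ i, ∀ᵐ ω ∂P, |Y i ω| ≤ C) (hmean : ∀ i, P[Y i] = 0)
    (hV : Tendsto (fun t => Var[fun ω => ∑ i ∈ Finset.range t, Y i ω; P]) atTop atTop) :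
    TendstoInDistribution (fun (t : ℕ) ω => (∑ i ∈ Finset.range t, Y i ω) /
        √Var[fun ω => ∑ i ∈ Finset.range t, Y i ω; P])
      atTop (id : ℝ → ℝ) (fun _ => P) (gaussianReal 0 1) where
  forall_aemeasurable t := (Finset.aemeasurable_fun_sum _ fun i _ => hY i).div_const _
  aemeasurable_limit := aemeasurable_id
  tendsto := by
    refine ProbabilityMeasure.tendsto_iff_tendsto_charFun.2 fun x => ?_
    have hσ := Real.tendsto_sqrt_atTop.comp hV
    have hgauss : charFun (gaussianReal 0 1) x = Real.exp (-(x ^ 2 / 2)) := by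
      simp [charFun_gaussianReal]
    simp only [ProbabilityMeasure.coe_mk, Measure.map_id, hgauss]
    rw [tendsto_iff_norm_sub_tendsto_zero]
    refine squeeze_zero' (Eventually.of_forall fun _ => norm_nonneg _) ?_
      ((tendsto_const_nhds (x := 2 * |x| ^ 3 * C)).div_atTop hσ)
    filter_upwards [hσ.eventually_ge_atTop (|x| * C), hσ.eventually_gt_atTop 0] with t hxC hpos
    exact norm_charFun_map_standardized_sub_exp_le hindep hY hC hmean _ hpos
      (Real.sq_sqrt (variance_nonneg _ _)).symm hxC

theorem tendstoInDistribution_standardized_sum_sub_integral {Y : ℕ → Ω → ℝ}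
    (hindep : iIndepFun Y P) (hY : ∀ i, AEMeasurable (Y i) P)
    (hC : ∀ i, ∀ᵐ ω ∂P, |Y i ω| ≤ C)
    (hV : Tendsto (fun t => Var[fun ω => ∑ i ∈ Finset.range t, Y i ω; P]) atTop atTop) :
    TendstoInDistribution (fun (t : ℕ) ω =>
        (∑ i ∈ Finset.range t, Y i ω - ∫ ω', ∑ i ∈ Finset.range t, Y i ω' ∂P) /
          √Var[fun ω => ∑ i ∈ Finset.range t, Y i ω; P])
      atTop (id : ℝ → ℝ) (fun _ => P) (gaussianReal 0 1) := by
  have hint : ∀ i, Integrable (Y i) P := fun i =>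
    (memLp_of_abs_le (hY i) (hC i) 1).integrable le_rfl
  have hcenter : ∀ (t : ℕ) ω, ∑ i ∈ Finset.range t, (Y i ω - P[Y i]) =
      ∑ i ∈ Finset.range t, Y i ω - ∫ ω', ∑ i ∈ Finset.range t, Y i ω' ∂P := fun t ω => by
    rw [Finset.sum_sub_distrib, integral_finsetSum _ fun i _ => hint i]
  have hvar : ∀ t : ℕ, Var[fun ω => ∑ i ∈ Finset.range t, (Y i ω - P[Y i]); P] =
      Var[fun ω => ∑ i ∈ Finset.range t, Y i ω; P] := fun t => by
    simp only [hcenter]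
    exact variance_sub_const (Finset.aemeasurable_fun_sum _ fun i _ => hY i).aestronglyMeasurable _
  have hindep' : iIndepFun (fun i ω => Y i ω - P[Y i]) P :=
    hindep.comp (fun i x => x - ∫ ω, Y i ω ∂P) fun i => measurable_id.sub_const _
  have hbound : ∀ i, ∀ᵐ ω ∂P, |Y i ω - P[Y i]| ≤ C + C := fun i => by
    have hmean : |P[Y i]| ≤ C := by
      simpa using norm_integral_le_of_norm_le_const (f := Y i) (hC i)
    filter_upwards [hC i] with ω hω
    exact (abs_sub _ _).trans (add_le_add hω hmean)
  have hmean : ∀ i, ∫ ω, (Y i ω - P[Y i]) ∂P = 0 := fun i => by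
    rw [integral_sub (hint i) (integrable_const _)]
    simp
  have hclt := tendstoInDistribution_standardized_sum hindep' (fun i => (hY i).sub_const _) hbound
    hmean (by simpa only [hvar] using hV)
  simp only [hvar] at hclt
  simpa only [hcenter] using hclt

end CentralLimit

section StrongLaw

theorem tendsto_div_succ_sq {w : ℕ → ℝ}
    (h : Tendsto (fun k : ℕ => w k / (k : ℝ) ^ 2) atTop (𝓝 1)) :
    Tendsto (fun k : ℕ => w k / ((k : ℝ) + 1) ^ 2) atTop (𝓝 1) := by
  have hratio : Tendsto (fun k : ℕ => ((k : ℝ) / (k + 1)) ^ 2) atTop (𝓝 1) := by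
    simpa using (tendsto_natCast_div_add_atTop (1 : ℝ)).pow 2
  have hmul := h.mul hratio
  rw [one_mul] at hmul
  refine hmul.congr' ?_
  filter_upwards [eventually_ne_atTop 0] with k hk
  field_simp

theorem tendsto_succ_div_sq {w : ℕ → ℝ}
    (h : Tendsto (fun k : ℕ => w k / (k : ℝ) ^ 2) atTop (𝓝 1)) :
    Tendsto (fun k : ℕ => w (k + 1) / (k : ℝ) ^ 2) atTop (𝓝 1) := by
  have hratio : Tendsto (fun k : ℕ => ((k : ℝ) / (k + 1)) ^ 2) atTop (𝓝 1) := by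
    simpa using (tendsto_natCast_div_add_atTop (1 : ℝ)).pow 2
  have hdiv := ((tendsto_add_atTop_iff_nat 1).2 h).div hratio one_ne_zero
  rw [div_one] at hdiv
  refine hdiv.congr' ?_
  filter_upwards [eventually_ne_atTop 0] with k hk
  simp only [Pi.div_apply, Nat.cast_succ]
  field_simp

theorem exists_firstPassage {ι : Type*} {a : ℕ → ℝ} (ha : Monotone a)
    (htop : Tendsto a atTop atTop) (b : ι → ℝ) : ∃ τ : ι → ℕ, ∀ k t, τ k ≤ t ↔ b k ≤ a t := by
  classical
  have hex : ∀ k, ∃ t, b k ≤ a t := fun k => (htop.eventually_ge_atTop (b k)).exists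
  refine ⟨fun k => Nat.find (hex k), fun k t => (Nat.find_le_iff _ _).trans ⟨?_, ?_⟩⟩
  · rintro ⟨s, hst, hs⟩
    exact hs.trans (ha hst)
  · exact fun ht => ⟨t, le_rfl, ht⟩

theorem apply_firstPassage_le {a : ℕ → ℝ} {b C : ℝ} {τ : ℕ} (hτ : ∀ t, τ ≤ t ↔ b ≤ a t)
    (h0 : a 0 ≤ b + C) (hstep : ∀ t, a (t + 1) ≤ a t + C) : a τ ≤ b + C := by
  cases τ with
  | zero => exact h0
  | succ t =>
    have hlt : a t < b := lt_of_not_ge fun hle => Nat.not_succ_le_self t ((hτ t).2 hle)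
    linarith [hstep t]

theorem tendsto_div_of_tendsto_firstPassage {a u : ℕ → ℝ} {τ : ℕ → ℕ} (hu : Monotone u)
    (hu0 : ∀ t, 0 ≤ u t) (htop : Tendsto a atTop atTop)
    (hτ : ∀ k t, τ k ≤ t ↔ (k : ℝ) ^ 2 ≤ a t)
    (hlim : Tendsto (fun k : ℕ => u (τ k) / (k : ℝ) ^ 2) atTop (𝓝 1)) :
    Tendsto (fun t => u t / a t) atTop (𝓝 1) := by
  have hfloor : Tendsto (fun t => ⌊√(a t)⌋₊) atTop atTop :=
    tendsto_nat_floor_atTop.comp (Real.tendsto_sqrt_atTop.comp htop)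
  have hlow : ∀ t, 0 ≤ a t → (⌊√(a t)⌋₊ : ℝ) ^ 2 ≤ a t := fun t ht =>
    (Real.le_sqrt (Nat.cast_nonneg _) ht).1 (Nat.floor_le (Real.sqrt_nonneg _))
  have hup : ∀ t, a t < ((⌊√(a t)⌋₊ : ℝ) + 1) ^ 2 := fun t => by
    rw [← Real.sqrt_lt' (by positivity)]
    exact Nat.lt_floor_add_one _
  refine tendsto_of_tendsto_of_tendsto_of_le_of_le' ((tendsto_div_succ_sq hlim).comp hfloor)
    ((tendsto_succ_div_sq hlim).comp hfloor) ?_ ?_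
  · filter_upwards [htop.eventually_gt_atTop 0] with t ht
    exact div_le_div₀ (hu0 t) (hu ((hτ _ _).2 (hlow t ht.le))) ht (hup t).le
  · filter_upwards [hfloor.eventually_gt_atTop 0, htop.eventually_ge_atTop 0] with t hpos ht
    have hlt : t < τ (⌊√(a t)⌋₊ + 1) := lt_of_not_ge fun hle =>
      ((hτ _ _).1 hle).not_gt (by exact_mod_cast hup t)
    exact div_le_div₀ (hu0 _) (hu hlt.le) (by positivity) (hlow t ht)

variable {Ω : Type*} [MeasurableSpace Ω] {P : Measure Ω}

theorem ae_tendsto_zero_of_summable_integral_sq {Y : ℕ → Ω → ℝ} (hY : ∀ k, MemLp (Y k) 2 P)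
    (hsum : Summable fun k => ∫ ω, Y k ω ^ 2 ∂P) :
    ∀ᵐ ω ∂P, Tendsto (fun k => Y k ω) atTop (𝓝 0) := by
  have hmeas : ∀ k, AEMeasurable (fun ω => ENNReal.ofReal (Y k ω ^ 2)) P := fun k =>
    ((hY k).aemeasurable.pow_const 2).ennreal_ofReal
  have hfin : ∫⁻ ω, ∑' k, ENNReal.ofReal (Y k ω ^ 2) ∂P ≠ ⊤ := by
    rw [lintegral_tsum hmeas]
    simp_rw [← ofReal_integral_eq_lintegral_ofReal (hY _).integrable_sq
      (ae_of_all _ fun _ => sq_nonneg _)]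
    exact hsum.tsum_ofReal_ne_top
  filter_upwards [ae_lt_top' (AEMeasurable.tsum hmeas) hfin] with ω hω
  have hsq : Tendsto (fun k => Y k ω ^ 2) atTop (𝓝 0) := by
    have h := (ENNReal.tendsto_toReal ENNReal.zero_ne_top).comp
      (ENNReal.tendsto_atTop_zero_of_tsum_ne_top hω.ne)
    simpa [Function.comp_def, ENNReal.toReal_ofReal, sq_nonneg] using h
  rw [tendsto_zero_iff_abs_tendsto_zero]
  simpa [Function.comp_def, Real.sqrt_sq_eq_abs] using (Real.continuous_sqrt.tendsto 0).comp hsq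

variable [IsProbabilityMeasure P] {C : ℝ}

theorem memLp_of_mem_Icc {Y : Ω → ℝ} (hY : AEMeasurable Y P)
    (hC : ∀ᵐ ω ∂P, Y ω ∈ Set.Icc 0 C) (p : ENNReal) : MemLp Y p P :=
  memLp_of_abs_le hY (hC.mono fun _ hω => (abs_of_nonneg hω.1).trans_le hω.2) p

theorem integral_mem_Icc {Y : Ω → ℝ} (hY : AEMeasurable Y P)
    (hC : ∀ᵐ ω ∂P, Y ω ∈ Set.Icc 0 C) : P[Y] ∈ Set.Icc 0 C := by
  refine ⟨integral_nonneg_of_ae (hC.mono fun _ hω => hω.1), ?_⟩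
  simpa using integral_mono_ae ((memLp_of_mem_Icc hY hC 1).integrable le_rfl)
    (integrable_const C) (hC.mono fun _ hω => hω.2)

theorem variance_le_mul_integral {Y : Ω → ℝ} (hY : AEMeasurable Y P)
    (hC : ∀ᵐ ω ∂P, Y ω ∈ Set.Icc 0 C) : Var[Y; P] ≤ C * P[Y] := by
  have hL2 := memLp_of_mem_Icc hY hC 2
  calc Var[Y; P] ≤ ∫ ω, Y ω ^ 2 ∂P := variance_le_expectation_sq hY.aestronglyMeasurable
    _ ≤ ∫ ω, C * Y ω ∂P := by
        refine integral_mono_ae hL2.integrable_sq ((hL2.integrable one_le_two).const_mul C) ?_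
        filter_upwards [hC] with ω hω
        nlinarith [hω.1, hω.2]
    _ = C * P[Y] := integral_const_mul _ _

theorem ae_tendsto_sub_integral_div_sq {S : ℕ → Ω → ℝ} (hS : ∀ k, MemLp (S k) 2 P)
    (hvar : ∀ k : ℕ, Var[S k; P] ≤ C * ((k : ℝ) ^ 2 + C)) :
    ∀ᵐ ω ∂P, Tendsto (fun k : ℕ => (S k ω - P[S k]) / (k : ℝ) ^ 2) atTop (𝓝 0) := by
  refine ae_tendsto_zero_of_summable_integral_sq (fun k => ?_) ?_
  · simpa only [div_eq_inv_mul, Pi.sub_apply] using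
      ((hS k).sub (memLp_const (P[S k]))).const_mul ((k : ℝ) ^ 2)⁻¹
  have hle : ∀ k : ℕ, ∫ ω, ((S k ω - P[S k]) / (k : ℝ) ^ 2) ^ 2 ∂P ≤
      (C + C ^ 2) * (1 / (k : ℝ) ^ 2) := fun k => by
    simp_rw [div_pow]
    rw [integral_div, ← variance_eq_integral (hS k).aemeasurable]
    obtain rfl | hk := Nat.eq_zero_or_pos k
    · simp
    have hk1 : (1 : ℝ) ≤ (k : ℝ) ^ 2 := one_le_pow₀ (by exact_mod_cast hk)
    calc Var[S k; P] / ((k : ℝ) ^ 2) ^ 2 ≤ ((C + C ^ 2) * (k : ℝ) ^ 2) / ((k : ℝ) ^ 2) ^ 2 := by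
          gcongr
          nlinarith [hvar k, sq_nonneg C]
      _ = (C + C ^ 2) * (1 / (k : ℝ) ^ 2) := by field_simp
  exact Summable.of_nonneg_of_le (fun k => integral_nonneg fun ω => sq_nonneg _) hle
    ((Real.summable_one_div_nat_pow.2 one_lt_two).mul_left _)

theorem variance_sum_le_mul_integral {ι : Type*} {Y : ι → Ω → ℝ}
    (hindep : Pairwise fun i j => Y i ⟂ᵢ[P] Y j) (hY : ∀ i, AEMeasurable (Y i) P)
    (hC : ∀ i, ∀ᵐ ω ∂P, Y i ω ∈ Set.Icc 0 C) (s : Finset ι) :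
    Var[fun ω => ∑ i ∈ s, Y i ω; P] ≤ C * ∫ ω, ∑ i ∈ s, Y i ω ∂P := by
  rw [variance_sum_of_pairwise_indepFun hindep (fun i => memLp_of_mem_Icc (hY i) (hC i) 2),
    integral_finsetSum _ fun i _ => (memLp_of_mem_Icc (hY i) (hC i) 1).integrable le_rfl,
    Finset.mul_sum]
  exact Finset.sum_le_sum fun i _ => variance_le_mul_integral (hY i) (hC i)

theorem tendsto_firstPassage_div_sq {a : ℕ → ℝ} {τ : ℕ → ℕ}
    (hτ : ∀ k t, τ k ≤ t ↔ (k : ℝ) ^ 2 ≤ a t) (hle : ∀ k : ℕ, a (τ k) ≤ (k : ℝ) ^ 2 + C) :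
    Tendsto (fun k : ℕ => a (τ k) / (k : ℝ) ^ 2) atTop (𝓝 1) := by
  have hsq : Tendsto (fun k : ℕ => (k : ℝ) ^ 2) atTop atTop :=
    (tendsto_pow_atTop two_ne_zero).comp tendsto_natCast_atTop_atTop
  have hup : Tendsto (fun k : ℕ => 1 + C / (k : ℝ) ^ 2) atTop (𝓝 1) := by
    simpa using ((tendsto_const_nhds (x := C)).div_atTop hsq).const_add 1
  refine tendsto_of_tendsto_of_tendsto_of_le_of_le' tendsto_const_nhds hup ?_ ?_
  · filter_upwards [hsq.eventually_gt_atTop 0] with k hk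
    exact (one_le_div hk).2 ((hτ k _).1 le_rfl)
  · filter_upwards [hsq.eventually_gt_atTop 0] with k hk
    rw [div_le_iff₀ hk, add_mul, one_mul, div_mul_cancel₀ _ hk.ne']
    exact hle k

-- The variance bound gives the convergence along the times at which the mean passes `k ^ 2`;
-- monotonicity of the partial sums fills the gaps.
theorem ae_tendsto_sum_div_integral {Y : ℕ → Ω → ℝ}
    (hindep : Pairwise fun i j => Y i ⟂ᵢ[P] Y j) (hY : ∀ i, AEMeasurable (Y i) P)
    (hC : ∀ i, ∀ᵐ ω ∂P, Y i ω ∈ Set.Icc 0 C)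
    (hE : Tendsto (fun t => ∫ ω, ∑ i ∈ Finset.range t, Y i ω ∂P) atTop atTop) :
    ∀ᵐ ω ∂P, Tendsto (fun t : ℕ => (∑ i ∈ Finset.range t, Y i ω) /
      ∫ ω', ∑ i ∈ Finset.range t, Y i ω' ∂P) atTop (𝓝 1) := by
  set a : ℕ → ℝ := fun t => ∫ ω, ∑ i ∈ Finset.range t, Y i ω ∂P
  have hmean : ∀ i, P[Y i] ∈ Set.Icc 0 C := fun i => integral_mem_Icc (hY i) (hC i)
  have hC0 : 0 ≤ C := (hmean 0).1.trans (hmean 0).2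
  have hsucc : ∀ t, a (t + 1) = a t + P[Y t] := fun t => by
    simp only [a, integral_finsetSum _ fun i _ =>
      (memLp_of_mem_Icc (hY i) (hC i) 1).integrable le_rfl, Finset.sum_range_succ]
  have ha : Monotone a := monotone_nat_of_le_succ fun t => by linarith [hsucc t, (hmean t).1]
  obtain ⟨τ, hτ⟩ := exists_firstPassage ha hE fun k : ℕ => (k : ℝ) ^ 2
  have hτ_le : ∀ k : ℕ, a (τ k) ≤ (k : ℝ) ^ 2 + C := fun k =>
    apply_firstPassage_le (hτ k)
      (by simp only [a, Finset.sum_range_zero, integral_zero]; positivity)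
      fun t => by linarith [hsucc t, (hmean t).2]
  have hdev := ae_tendsto_sub_integral_div_sq
    (fun k => memLp_finsetSum (Finset.range (τ k)) fun i _ => memLp_of_mem_Icc (hY i) (hC i) 2)
    fun k => (variance_sum_le_mul_integral hindep hY hC _).trans
      (mul_le_mul_of_nonneg_left (hτ_le k) hC0)
  filter_upwards [hdev, ae_all_iff.2 hC] with ω hω hYω
  refine tendsto_div_of_tendsto_firstPassage
    (monotone_nat_of_le_succ fun t => ?_) (fun t => Finset.sum_nonneg fun i _ => (hYω i).1) hE hτ ?_
  · rw [Finset.sum_range_succ]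
    linarith [(hYω t).1]
  · have hadd := hω.add (tendsto_firstPassage_div_sq hτ hτ_le)
    rw [zero_add] at hadd
    exact hadd.congr fun k => by rw [← add_div, sub_add_cancel]

end StrongLaw

section Independence

variable {Ω : Type*} [MeasurableSpace Ω] {P : Measure Ω}

theorem iIndepFun_of_indepFun_Iio [IsProbabilityMeasure P] {ι : Type*} [LinearOrder ι]
    {β : ι → Type*} [∀ i, MeasurableSpace (β i)] {D : ∀ i, Ω → β i}
    (h : ∀ t, (fun ω (i : Set.Iio t) => D i ω) ⟂ᵢ[P] D t) : iIndepFun D P := by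
  rw [iIndepFun_iff_measure_inter_preimage_eq_mul]
  intro S B hB
  induction S using Finset.induction_on_max with
  | empty => simp
  | insert a S hlt ih =>
    have ha : a ∉ S := fun haS => (hlt a haS).false
    have hpi : ⋂ i ∈ S, D i ⁻¹' B i = (fun ω (i : Set.Iio a) => D i ω) ⁻¹'
        Set.pi {i | (i : ι) ∈ S} fun i => B i := by
      ext ω
      simp only [Set.mem_iInter, Set.mem_preimage, Set.mem_pi, Set.mem_ofPred_eq, Subtype.forall]
      exact ⟨fun hω i _ hi => hω i hi, fun hω i hi => hω i (hlt i hi) hi⟩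
    have hmeas : MeasurableSet
        (Set.pi {i : Set.Iio a | (i : ι) ∈ S} fun i => B i) :=
      MeasurableSet.pi (S.finite_toSet.preimage Subtype.val_injective.injOn).countable
        fun i hi => hB i (Finset.mem_insert_of_mem hi)
    rw [Finset.prod_insert ha, ← ih fun i hi => hB i (Finset.mem_insert_of_mem hi),
      Finset.set_biInter_insert, Set.inter_comm, mul_comm, hpi]
    exact (h a).measure_inter_preimage_eq_mul _ _ hmeas (hB a (Finset.mem_insert_self a S))

variable {α β : Type*} [MeasurableSpace α] [Countable α] [MeasurableSingletonClass α]
  [MeasurableSpace β] {H : Ω → α} {D : Ω → β} {ν : Measure β}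

theorem measure_preimage_inter_preimage_eq_mul (hH : Measurable H)
    (h : ∀ ω B, MeasurableSet B → P (H ⁻¹' {H ω} ∩ D ⁻¹' B) = P (H ⁻¹' {H ω}) * ν B)
    (A : Set α) {B : Set β} (hB : MeasurableSet B) :
    P (H ⁻¹' A ∩ D ⁻¹' B) = P (H ⁻¹' A) * ν B := by
  have hmap : (P.restrict (D ⁻¹' B)).map H = ν B • P.map H := by
    refine Measure.ext_of_singleton fun a => ?_
    have ha := measurableSet_singleton a
    rw [Measure.smul_apply, Measure.map_apply hH ha, Measure.map_apply hH ha,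
      Measure.restrict_apply (hH ha), smul_eq_mul, mul_comm]
    obtain hempty | ⟨ω, rfl⟩ := (H ⁻¹' {a}).eq_empty_or_nonempty
    · simp [hempty]
    · exact h ω B hB
  have hA := A.to_countable.measurableSet
  have happly := congrArg (fun μ => μ A) hmap
  simp only [Measure.smul_apply, smul_eq_mul, Measure.map_apply hH hA,
    Measure.restrict_apply (hH hA)] at happly
  rw [happly, mul_comm]

variable [IsProbabilityMeasure P]

theorem hasLaw_of_measure_inter_preimage_eq_mul (hH : Measurable H) (hD : Measurable D)
    (h : ∀ ω B, MeasurableSet B → P (H ⁻¹' {H ω} ∩ D ⁻¹' B) = P (H ⁻¹' {H ω}) * ν B) :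
    HasLaw D ν P where
  aemeasurable := hD.aemeasurable
  map_eq := by
    ext B hB
    rw [Measure.map_apply hD hB]
    simpa using measure_preimage_inter_preimage_eq_mul hH h Set.univ hB

theorem indepFun_of_measure_inter_preimage_eq_mul (hH : Measurable H) (hD : Measurable D)
    (h : ∀ ω B, MeasurableSet B → P (H ⁻¹' {H ω} ∩ D ⁻¹' B) = P (H ⁻¹' {H ω}) * ν B) :
    H ⟂ᵢ[P] D := by
  rw [indepFun_iff_measure_inter_preimage_eq_mul]
  intro A B _ hB
  rw [measure_preimage_inter_preimage_eq_mul hH h A hB, ← Measure.map_apply hD hB,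
    (hasLaw_of_measure_inter_preimage_eq_mul hH hD h).map_eq]

end Independence

section NewCycleProb

theorem natCast_mul_sub_one_nonneg (k : ℕ) : (0 : ℝ) ≤ k * (k - 1) := by
  rcases k with _ | k
  · simp
  · push_cast
    rw [add_sub_cancel_right]
    positivity

theorem multichoose_succ_mul (N j : ℕ) :
    Nat.multichoose N (j + 1) * (j + 1) = Nat.multichoose N j * (N + j) := by
  rcases N with _ | N
  · rcases j with _ | j <;> simp
  · rw [Nat.multichoose_eq, Nat.multichoose_eq, show N + 1 + (j + 1) - 1 = N + j + 1 by omega,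
      show N + 1 + j - 1 = N + j by omega, ← Nat.add_one_mul_choose_eq]
    ring

/-- The probability that, of `m` copies inserted into a permutation with `N` entries, exactly `k`
form new singleton cycles. -/
noncomputable def newCycleProb (θ : ℝ) (N m k : ℕ) : ℝ :=
  (Nat.multichoose N (m - k) : ℝ) * θ ^ k /
    ∑ j ∈ Finset.range (m + 1), (Nat.multichoose N (m - j) : ℝ) * θ ^ j

/-- The mean number of new cycles when `m` copies are inserted into a permutation with `N`
entries. -/
noncomputable def newCycleMean (θ : ℝ) (N m : ℕ) : ℝ :=
  ∑ k ∈ Finset.range (m + 1), newCycleProb θ N m k * k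

/-- The second factorial moment of the number of new cycles when `m` copies are inserted into a
permutation with `N` entries. -/
noncomputable def newCycleFactorialMoment (θ : ℝ) (N m : ℕ) : ℝ :=
  ∑ k ∈ Finset.range (m + 1), newCycleProb θ N m k * (k * (k - 1))

variable {θ : ℝ} (hθ : 0 < θ) (N m : ℕ)
include hθ

theorem sum_multichoose_mul_pow_pos :
    0 < ∑ k ∈ Finset.range (m + 1), (Nat.multichoose N (m - k) : ℝ) * θ ^ k := by
  refine Finset.sum_pos' (fun k _ => by positivity) ⟨m, Finset.self_mem_range_succ m, ?_⟩
  simp [hθ]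

theorem newCycleProb_nonneg (k : ℕ) : 0 ≤ newCycleProb θ N m k :=
  div_nonneg (by positivity) (sum_multichoose_mul_pow_pos hθ N m).le

theorem sum_newCycleProb : ∑ k ∈ Finset.range (m + 1), newCycleProb θ N m k = 1 := by
  simp_rw [newCycleProb]
  rw [← Finset.sum_div]
  exact div_self (sum_multichoose_mul_pow_pos hθ N m).ne'

theorem newCycleProb_pos {N : ℕ} (hN : 1 ≤ N) (k : ℕ) : 0 < newCycleProb θ N m k := by
  have hpos : 0 < Nat.multichoose N (m - k) := by
    rw [Nat.multichoose_eq]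
    exact Nat.choose_pos (by omega)
  exact div_pos (by positivity) (sum_multichoose_mul_pow_pos hθ N m)

omit hθ in
theorem newCycleProb_succ_mul {k : ℕ} (hk : k < m) :
    newCycleProb θ N m (k + 1) * (N + m - (k + 1 : ℕ)) =
      θ * (newCycleProb θ N m k * (m - k)) := by
  obtain ⟨j, rfl⟩ := Nat.exists_eq_add_of_lt hk
  have hrec : (Nat.multichoose N (j + 1) : ℝ) * (j + 1) = Nat.multichoose N j * (N + j) :=
    mod_cast multichoose_succ_mul N j
  rw [newCycleProb, newCycleProb, show k + j + 1 - (k + 1) = j by omega,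
    show k + j + 1 - k = j + 1 by omega]
  push_cast
  linear_combination (-θ ^ (k + 1) * (∑ i ∈ Finset.range (k + j + 1 + 1),
    (Nat.multichoose N (k + j + 1 - i) : ℝ) * θ ^ i)⁻¹) * hrec

-- A Stein identity, obtained by summing `newCycleProb_succ_mul` against `g`; all the moment bounds
-- below are read off from it.
omit hθ in
theorem sum_newCycleProb_mul_eq {g : ℕ → ℝ} (hg : g 0 = 0) :
    ∑ k ∈ Finset.range (m + 1), newCycleProb θ N m k * ((N + m - k) * g k) =
      θ * ∑ k ∈ Finset.range (m + 1), newCycleProb θ N m k * ((m - k) * g (k + 1)) := by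
  rw [Finset.sum_range_succ', Finset.sum_range_succ, hg, sub_self]
  simp only [mul_zero, zero_mul, add_zero, Finset.mul_sum]
  refine Finset.sum_congr rfl fun k hk => ?_
  linear_combination g (k + 1) * newCycleProb_succ_mul (θ := θ) N m (Finset.mem_range.1 hk)

theorem newCycleMean_nonneg : 0 ≤ newCycleMean θ N m :=
  Finset.sum_nonneg fun k _ => mul_nonneg (newCycleProb_nonneg hθ N m k) k.cast_nonneg

theorem newCycleMean_pos {N m : ℕ} (hN : 1 ≤ N) (hm : 1 ≤ m) : 0 < newCycleMean θ N m := by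
  refine Finset.sum_pos' (fun k _ => mul_nonneg (newCycleProb_nonneg hθ N m k) k.cast_nonneg)
    ⟨1, Finset.mem_range.2 (by omega), ?_⟩
  simpa using newCycleProb_pos hθ m hN 1

theorem newCycleMean_le : newCycleMean θ N m ≤ m := by
  rw [← one_mul (m : ℝ), ← sum_newCycleProb hθ N m, Finset.sum_mul]
  refine Finset.sum_le_sum fun k hk => ?_
  have hkm : (k : ℝ) ≤ m := mod_cast Finset.mem_range_succ_iff.1 hk
  exact mul_le_mul_of_nonneg_left hkm (newCycleProb_nonneg hθ N m k)

theorem newCycleFactorialMoment_nonneg : 0 ≤ newCycleFactorialMoment θ N m :=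
  Finset.sum_nonneg fun k _ =>
    mul_nonneg (newCycleProb_nonneg hθ N m k) (natCast_mul_sub_one_nonneg k)

theorem newCycleFactorialMoment_le :
    newCycleFactorialMoment θ N m ≤ (m - 1) * newCycleMean θ N m := by
  rw [newCycleFactorialMoment, newCycleMean, Finset.mul_sum]
  refine Finset.sum_le_sum fun k hk => ?_
  have hkm : (k : ℝ) ≤ m := mod_cast Finset.mem_range_succ_iff.1 hk
  have hpk : 0 ≤ newCycleProb θ N m k * k := mul_nonneg (newCycleProb_nonneg hθ N m k) (by simp)
  nlinarith

theorem mul_newCycleMean_eq :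
    (N + m) * newCycleMean θ N m - (newCycleFactorialMoment θ N m + newCycleMean θ N m) =
      θ * (m + (m - 1) * newCycleMean θ N m -
        (newCycleFactorialMoment θ N m + newCycleMean θ N m)) := by
  have hstein := sum_newCycleProb_mul_eq (θ := θ) N m (g := fun k => (k : ℝ)) (by simp)
  have hone := sum_newCycleProb hθ N m
  have hleft : ∑ k ∈ Finset.range (m + 1), newCycleProb θ N m k * ((N + m - k) * k) =
      (N + m) * newCycleMean θ N m -
        (newCycleFactorialMoment θ N m + newCycleMean θ N m) := by
    simp only [newCycleMean, newCycleFactorialMoment, Finset.mul_sum, ← Finset.sum_add_distrib,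
      ← Finset.sum_sub_distrib]
    exact Finset.sum_congr rfl fun k _ => by ring
  have hright : ∑ k ∈ Finset.range (m + 1), newCycleProb θ N m k * ((m - k) * (k + 1 : ℕ)) =
      m * ∑ k ∈ Finset.range (m + 1), newCycleProb θ N m k + (m - 1) * newCycleMean θ N m -
        (newCycleFactorialMoment θ N m + newCycleMean θ N m) := by
    simp only [newCycleMean, newCycleFactorialMoment, Finset.mul_sum, ← Finset.sum_add_distrib,
      ← Finset.sum_sub_distrib]
    exact Finset.sum_congr rfl fun k _ => by push_cast; ring
  rw [← hleft, hstein, hright, hone, mul_one]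

theorem abs_mul_newCycleMean_sub_le :
    |N * newCycleMean θ N m - θ * m| ≤ (1 + θ) * m * newCycleMean θ N m := by
  have heq := mul_newCycleMean_eq hθ N m
  have hq := newCycleFactorialMoment_nonneg hθ N m
  have hqle := newCycleFactorialMoment_le hθ N m
  have hμ := newCycleMean_nonneg hθ N m
  rw [abs_le]
  constructor <;> nlinarith

theorem mul_newCycleMean_le : N * newCycleMean θ N m ≤ (1 + 2 * θ) * m ^ 2 := by
  have hm : (m : ℝ) ≤ m ^ 2 := mod_cast Nat.le_self_pow two_ne_zero m
  have hle : m * newCycleMean θ N m ≤ m * m :=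
    mul_le_mul_of_nonneg_left (newCycleMean_le hθ N m) m.cast_nonneg
  nlinarith [(abs_le.1 (abs_mul_newCycleMean_sub_le hθ N m)).2]

theorem mul_newCycleFactorialMoment_le :
    N * newCycleFactorialMoment θ N m ≤ θ * m * (m + 1) * newCycleMean θ N m := by
  have hle {k : ℕ} (hk : k ∈ Finset.range (m + 1)) : (k : ℝ) ≤ m :=
    mod_cast Finset.mem_range_succ_iff.1 hk
  calc N * newCycleFactorialMoment θ N m
      ≤ ∑ k ∈ Finset.range (m + 1), newCycleProb θ N m k * ((N + m - k) * (k * (k - 1))) := by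
        rw [newCycleFactorialMoment, Finset.mul_sum]
        refine Finset.sum_le_sum fun k hk => ?_
        rw [mul_left_comm]
        refine mul_le_mul_of_nonneg_left ?_ (newCycleProb_nonneg hθ N m k)
        exact mul_le_mul_of_nonneg_right (by linarith [hle hk]) (natCast_mul_sub_one_nonneg k)
    _ = θ * ∑ k ∈ Finset.range (m + 1),
          newCycleProb θ N m k * ((m - k) * ((k + 1 : ℕ) * ((k + 1 : ℕ) - 1))) :=
        sum_newCycleProb_mul_eq N m (g := fun k => (k * (k - 1) : ℝ)) (by simp)
    _ ≤ θ * ∑ k ∈ Finset.range (m + 1), newCycleProb θ N m k * (m * ((m + 1) * k)) := by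
        gcongr with k hk
        · exact newCycleProb_nonneg hθ N m k
        · exact natCast_mul_sub_one_nonneg (k + 1)
        · linarith [k.cast_nonneg (α := ℝ)]
        · push_cast
          linarith [k.cast_nonneg (α := ℝ)]
        · push_cast
          linarith [hle hk]
        · push_cast
          linarith
    _ = θ * m * (m + 1) * newCycleMean θ N m := by
        simp only [newCycleMean, Finset.mul_sum]
        exact Finset.sum_congr rfl fun k _ => by ring

variable {N : ℕ} (hN : 1 ≤ N)
include hN

theorem newCycleMean_le_div : newCycleMean θ N m ≤ (1 + 2 * θ) * m ^ 2 / N := by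
  rw [le_div_iff₀' (by positivity)]
  exact mul_newCycleMean_le hθ N m

theorem sq_newCycleMean_le : newCycleMean θ N m ^ 2 ≤ (1 + 2 * θ) ^ 2 * m ^ 4 / N ^ 2 := by
  calc newCycleMean θ N m ^ 2 ≤ ((1 + 2 * θ) * m ^ 2 / N) ^ 2 :=
        pow_le_pow_left₀ (newCycleMean_nonneg hθ N m) (newCycleMean_le_div hθ m hN) 2
    _ = (1 + 2 * θ) ^ 2 * m ^ 4 / N ^ 2 := by ring

theorem abs_newCycleMean_sub_le :
    |newCycleMean θ N m - θ * m / N| ≤ (1 + 2 * θ) ^ 2 * m ^ 4 / N ^ 2 := by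
  have hN0 : (0 : ℝ) < N := by positivity
  have hm : (m : ℝ) ≤ m ^ 2 := mod_cast Nat.le_self_pow two_ne_zero m
  calc |newCycleMean θ N m - θ * m / N| = |N * newCycleMean θ N m - θ * m| / N := by
        rw [← abs_of_pos hN0, ← abs_div, abs_of_pos hN0, sub_div, mul_div_cancel_left₀ _ hN0.ne']
    _ ≤ (1 + 2 * θ) * m ^ 2 * newCycleMean θ N m / N := by
        gcongr
        refine (abs_mul_newCycleMean_sub_le hθ N m).trans ?_
        have := newCycleMean_nonneg hθ N m
        gcongr
        linarith
    _ ≤ (1 + 2 * θ) * m ^ 2 * ((1 + 2 * θ) * m ^ 2 / N) / N := by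
        gcongr
        exact newCycleMean_le_div hθ m hN
    _ = (1 + 2 * θ) ^ 2 * m ^ 4 / N ^ 2 := by field_simp

theorem newCycleFactorialMoment_le_div :
    newCycleFactorialMoment θ N m ≤ (1 + 2 * θ) ^ 2 * m ^ 4 / N ^ 2 := by
  have hN0 : (0 : ℝ) < N := by positivity
  have hm : (m : ℝ) ≤ m ^ 2 := mod_cast Nat.le_self_pow two_ne_zero m
  have hcoeff : θ * m * (m + 1) ≤ (1 + 2 * θ) * m ^ 2 := by nlinarith
  calc newCycleFactorialMoment θ N m ≤ θ * m * (m + 1) * newCycleMean θ N m / N := by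
        rw [le_div_iff₀' hN0]
        exact mul_newCycleFactorialMoment_le hθ N m
    _ ≤ (1 + 2 * θ) * m ^ 2 * ((1 + 2 * θ) * m ^ 2 / N) / N := by
        have := newCycleMean_le_div hθ m hN
        have := newCycleMean_nonneg hθ N m
        gcongr
    _ = (1 + 2 * θ) ^ 2 * m ^ 4 / N ^ 2 := by field_simp

end NewCycleProb

section NewCycleLaw

/-- The law on `ℝ` of the number of new cycles when `m` copies are inserted into a permutation with
`N` entries. -/
noncomputable def newCycleLaw (θ : ℝ) (N m : ℕ) : Measure ℝ :=
  ∑ k ∈ Finset.range (m + 1), ENNReal.ofReal (newCycleProb θ N m k) • Measure.dirac (k : ℝ)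

theorem ae_newCycleLaw_mem_Icc (θ : ℝ) (N m : ℕ) :
    ∀ᵐ x ∂(newCycleLaw θ N m), x ∈ Set.Icc 0 (m : ℝ) := by
  rw [newCycleLaw, ae_iff]
  simp only [Measure.coe_finsetSum, Finset.sum_apply, Measure.smul_apply, smul_eq_mul]
  refine Finset.sum_eq_zero fun k hk => ?_
  rw [Measure.dirac_apply]
  simp [Finset.mem_range_succ_iff.1 hk]

variable {θ : ℝ} (hθ : 0 < θ) (N m : ℕ)
include hθ

theorem integral_newCycleLaw (f : ℝ → ℝ) :
    ∫ x, f x ∂(newCycleLaw θ N m) = ∑ k ∈ Finset.range (m + 1), newCycleProb θ N m k * f k := by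
  rw [newCycleLaw, integral_finsetSum_measure fun k _ =>
    (integrable_dirac (by simp)).smul_measure ENNReal.ofReal_ne_top]
  refine Finset.sum_congr rfl fun k _ => ?_
  rw [integral_smul_measure, integral_dirac,
    ENNReal.toReal_ofReal (newCycleProb_nonneg hθ N m k), smul_eq_mul]

theorem integral_id_newCycleLaw : ∫ x, x ∂(newCycleLaw θ N m) = newCycleMean θ N m :=
  integral_newCycleLaw hθ N m id

theorem variance_newCycleLaw : Var[id; newCycleLaw θ N m] =
    ∑ k ∈ Finset.range (m + 1), newCycleProb θ N m k * (k - newCycleMean θ N m) ^ 2 := by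
  simp only [variance_eq_integral aemeasurable_id, id_eq, integral_id_newCycleLaw hθ,
    integral_newCycleLaw hθ N m fun x => (x - newCycleMean θ N m) ^ 2]

theorem variance_newCycleLaw_eq : Var[id; newCycleLaw θ N m] =
    newCycleMean θ N m + newCycleFactorialMoment θ N m - newCycleMean θ N m ^ 2 := by
  have hone := sum_newCycleProb hθ N m
  set μ := newCycleMean θ N m
  calc Var[id; newCycleLaw θ N m]
      = newCycleFactorialMoment θ N m + newCycleMean θ N m - 2 * μ * newCycleMean θ N m +
          μ ^ 2 * ∑ k ∈ Finset.range (m + 1), newCycleProb θ N m k := by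
        rw [variance_newCycleLaw hθ]
        simp only [newCycleMean, newCycleFactorialMoment, Finset.mul_sum,
          ← Finset.sum_add_distrib, ← Finset.sum_sub_distrib]
        exact Finset.sum_congr rfl fun k _ => by rw [← newCycleMean]; ring
    _ = μ + newCycleFactorialMoment θ N m - μ ^ 2 := by rw [hone]; ring

variable {N m : ℕ} (hN : 1 ≤ N)
include hN

theorem abs_variance_newCycleLaw_sub_le :
    |Var[id; newCycleLaw θ N m] - θ * m / N| ≤ 2 * ((1 + 2 * θ) ^ 2 * m ^ 4 / N ^ 2) := by
  have hmean := abs_le.1 (abs_newCycleMean_sub_le hθ m hN)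
  have hmoment := newCycleFactorialMoment_le_div hθ m hN
  have hmoment_nonneg := newCycleFactorialMoment_nonneg hθ N m
  have hsq := sq_newCycleMean_le hθ m hN
  rw [variance_newCycleLaw_eq hθ, abs_le]
  constructor <;> linarith [hmean.1, hmean.2, sq_nonneg (newCycleMean θ N m)]

theorem variance_newCycleLaw_pos (hm : 1 ≤ m) : 0 < Var[id; newCycleLaw θ N m] := by
  rw [variance_newCycleLaw hθ]
  refine Finset.sum_pos' (fun k _ => mul_nonneg (newCycleProb_nonneg hθ N m k) (sq_nonneg _))
    ⟨0, by simp, mul_pos (newCycleProb_pos hθ m hN 0) ?_⟩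
  have := newCycleMean_pos hθ hN hm
  rw [Nat.cast_zero, zero_sub, neg_sq]
  positivity

end NewCycleLaw

section Chain

instance : Countable MCycle :=
  Function.Injective.countable (f := fun c : MCycle => (c.xs, c.y)) fun c d h => by
    rw [Prod.mk.injEq] at h
    exact MCycle.ext h.1 h.2

instance (n : ℕ → ℕ) (t : ℕ) : Countable (MultisetPerm n t) :=
  Function.Injective.countable (f := MultisetPerm.cycles) fun _ _ h => MultisetPerm.ext h

instance (n : ℕ → ℕ) (t : ℕ) : DiscreteMeasurableSpace (MultisetPerm n t) :=
  ⟨fun _ => trivial⟩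

variable {n : ℕ → ℕ} {t : ℕ} {θ : ℝ}

theorem MultisetPerm.numCycles_extend (π : MultisetPerm n t) (k : Fin (n (t + 1) + 1))
    (s : Sym (Place π.cycles) (n (t + 1) - k)) :
    (π.extend k s).numCycles = π.numCycles + k := by
  simp [MultisetPerm.numCycles, MultisetPerm.extend, insertCopies]

theorem card_sum_word (l : List MCycle) :
    Multiset.card (l.map fun c => (c.word : Multiset ℕ)).sum = Fintype.card (Place l) := by
  rw [← Multiset.cardHom_apply, map_list_sum, List.map_map, Fintype.card_sigma, ← List.sum_ofFn]
  conv_lhs => rw [← List.ofFn_get l, List.map_ofFn]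
  simp [Function.comp_def, MCycle.word]

theorem MultisetPerm.card_place (π : MultisetPerm n t) :
    Fintype.card (Place π.cycles) = totalSize n t := by
  rw [← card_sum_word, π.content]
  simp [baseMultiset, totalSize]

theorem MultisetPerm.numCycles_zero (π : MultisetPerm n 0) : π.numCycles = 0 := by
  have hempty : IsEmpty (Place π.cycles) := by
    rw [← Fintype.card_eq_zero_iff, π.card_place]
    rfl
  by_contra hne
  exact hempty.elim ⟨⟨0, Nat.pos_of_ne_zero hne⟩, 0⟩

theorem normalizer_pos (hθ : 0 < θ) (n : ℕ → ℕ) (t : ℕ) : 0 < normalizer θ n t :=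
  sum_multichoose_mul_pow_pos hθ _ _

/-- The law of the state at time `t + 1` of a multiset Chinese restaurant process which is in the
state `π` at time `t`, i.e. `transitionProb` as a measure. -/
noncomputable def transitionMeasure (θ : ℝ) (π : MultisetPerm n t) :
    Measure (MultisetPerm n (t + 1)) :=
  ∑ k : Fin (n (t + 1) + 1), ∑ s : Sym (Place π.cycles) (n (t + 1) - k),
    ENNReal.ofReal (θ ^ (k : ℕ) / normalizer θ n t) • Measure.dirac (π.extend k s)

theorem transitionMeasure_singleton (hθ : 0 < θ) (π : MultisetPerm n t)
    (π' : MultisetPerm n (t + 1)) :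
    transitionMeasure θ π {π'} = ENNReal.ofReal (transitionProb θ π π') := by
  classical
  have hnonneg : ∀ (k : Fin (n (t + 1) + 1)) (s : Sym (Place π.cycles) (n (t + 1) - k)),
      0 ≤ if π.extend k s = π' then θ ^ (k : ℕ) / normalizer θ n t else 0 := fun k s => by
    have := normalizer_pos hθ n t
    positivity
  rw [transitionMeasure, transitionProb,
    ENNReal.ofReal_sum_of_nonneg fun k _ => Finset.sum_nonneg fun s _ => hnonneg k s]
  simp only [Measure.coe_finsetSum, Finset.sum_apply, Measure.smul_apply, smul_eq_mul,
    ENNReal.ofReal_sum_of_nonneg fun s _ => hnonneg _ s]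
  refine Finset.sum_congr rfl fun k _ => Finset.sum_congr rfl fun s _ => ?_
  rw [Measure.dirac_apply]
  by_cases h : π.extend k s = π' <;> simp [h]

theorem transitionMeasure_setOf_numCycles_sub_mem (θ : ℝ) (π : MultisetPerm n t) {B : Set ℝ}
    (hB : MeasurableSet B) :
    transitionMeasure θ π {π' | (π'.numCycles : ℝ) - π.numCycles ∈ B} =
      newCycleLaw θ (totalSize n t) (n (t + 1)) B := by
  classical
  have hdirac : ∀ (k : Fin (n (t + 1) + 1)) (s : Sym (Place π.cycles) (n (t + 1) - k)),
      Measure.dirac (π.extend k s) {π' | (π'.numCycles : ℝ) - π.numCycles ∈ B} =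
        Measure.dirac ((k : ℕ) : ℝ) B := fun k s => by
    rw [Measure.dirac_apply, Measure.dirac_apply' _ hB]
    simp [Set.indicator, MultisetPerm.numCycles_extend]
  simp only [transitionMeasure, newCycleLaw, Measure.coe_finsetSum, Finset.sum_apply,
    Measure.smul_apply, smul_eq_mul, hdirac]
  rw [Finset.sum_range]
  refine Finset.sum_congr rfl fun k _ => ?_
  rw [Finset.sum_const, nsmul_eq_mul, Finset.card_univ, Sym.card_sym_eq_multichoose, π.card_place,
    ← mul_assoc, ← ENNReal.ofReal_natCast, ← ENNReal.ofReal_mul (Nat.cast_nonneg _), newCycleProb,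
    mul_div_assoc]
  rfl

variable {Ω : Type*}

/-- The number of new cycles created between the times `t` and `t + 1`; it is real-valued in order
to speak of its mean and variance. -/
noncomputable def newCycles (X : (t : ℕ) → Ω → MultisetPerm n t) (t : ℕ) (ω : Ω) : ℝ :=
  (X (t + 1) ω).numCycles - (X t ω).numCycles

theorem sum_range_newCycles (X : (t : ℕ) → Ω → MultisetPerm n t) (t : ℕ) (ω : Ω) :
    ∑ i ∈ Finset.range t, newCycles X i ω = (X t ω).numCycles := by
  simp only [newCycles]
  rw [Finset.sum_range_sub fun i => ((X i ω).numCycles : ℝ), MultisetPerm.numCycles_zero]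
  simp

/-- The states of the process up to time `t`. -/
def history (X : (t : ℕ) → Ω → MultisetPerm n t) (t : ℕ) (ω : Ω) (s : Set.Iic t) :
    MultisetPerm n s :=
  X s ω

variable [MeasurableSpace Ω] {P : Measure Ω} {X : (t : ℕ) → Ω → MultisetPerm n t}

theorem IsCRP.measurable_newCycles (hX : IsCRP P θ n X) (t : ℕ) : Measurable (newCycles X t) :=
  ((Measurable.of_discrete (f := fun π : MultisetPerm n (t + 1) => (π.numCycles : ℝ))).comp
    (hX.measurable (t + 1))).sub
  ((Measurable.of_discrete (f := fun π : MultisetPerm n t => (π.numCycles : ℝ))).comp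
    (hX.measurable t))

theorem IsCRP.measurable_history (hX : IsCRP P θ n X) (t : ℕ) : Measurable (history X t) :=
  measurable_pi_lambda _ fun s => hX.measurable s

variable [IsProbabilityMeasure P]

theorem IsCRP.measure_inter_preimage_singleton (hX : IsCRP P θ n X) (hθ : 0 < θ)
    (π : (s : ℕ) → MultisetPerm n s) (t : ℕ) (π' : MultisetPerm n (t + 1)) :
    P ({ω | ∀ s ≤ t, X s ω = π s} ∩ X (t + 1) ⁻¹' {π'}) =
      P {ω | ∀ s ≤ t, X s ω = π s} * transitionMeasure θ (π t) {π'} := by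
  have hupdate : ∀ s ≤ t, Function.update π (t + 1) π' s = π s := fun s hs =>
    Function.update_of_ne (by omega) _ _
  have hmarkov := hX.markov t (Function.update π (t + 1) π')
  have hpast : {ω | ∀ s ≤ t, X s ω = Function.update π (t + 1) π' s} =
      {ω | ∀ s ≤ t, X s ω = π s} := by
    ext ω
    exact forall₂_congr fun s hs => by rw [hupdate s hs]
  have hsucc : {ω | ∀ s ≤ t + 1, X s ω = Function.update π (t + 1) π' s} =
      {ω | ∀ s ≤ t, X s ω = π s} ∩ X (t + 1) ⁻¹' {π'} := by
    rw [← hpast]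
    ext ω
    simp [Nat.le_succ_iff, or_imp, forall_and]
  rw [hsucc, hpast, hupdate t le_rfl, Function.update_self] at hmarkov
  rw [transitionMeasure_singleton hθ, ← ofReal_measureReal, hmarkov,
    ENNReal.ofReal_mul measureReal_nonneg, ofReal_measureReal]

theorem IsCRP.measure_inter_preimage (hX : IsCRP P θ n X) (hθ : 0 < θ)
    (π : (s : ℕ) → MultisetPerm n s) (t : ℕ) (S : Set (MultisetPerm n (t + 1))) :
    P ({ω | ∀ s ≤ t, X s ω = π s} ∩ X (t + 1) ⁻¹' S) =
      P {ω | ∀ s ≤ t, X s ω = π s} * transitionMeasure θ (π t) S := by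
  set A := {ω | ∀ s ≤ t, X s ω = π s}
  have hrestrict : ∀ S, (P.restrict A).map (X (t + 1)) S = P (A ∩ X (t + 1) ⁻¹' S) := fun S => by
    rw [Measure.map_apply (hX.measurable _) .of_discrete,
      Measure.restrict_apply (hX.measurable _ .of_discrete), Set.inter_comm]
  have hmap : (P.restrict A).map (X (t + 1)) = P A • transitionMeasure θ (π t) :=
    Measure.ext_of_singleton fun π' => by
      rw [hrestrict, hX.measure_inter_preimage_singleton hθ, Measure.smul_apply, smul_eq_mul]
  rw [← hrestrict, hmap, Measure.smul_apply, smul_eq_mul]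

theorem IsCRP.measure_inter_preimage_newCycles (hX : IsCRP P θ n X) (hθ : 0 < θ)
    (π : (s : ℕ) → MultisetPerm n s) (t : ℕ) {B : Set ℝ} (hB : MeasurableSet B) :
    P ({ω | ∀ s ≤ t, X s ω = π s} ∩ newCycles X t ⁻¹' B) =
      P {ω | ∀ s ≤ t, X s ω = π s} * newCycleLaw θ (totalSize n t) (n (t + 1)) B := by
  rw [← transitionMeasure_setOf_numCycles_sub_mem θ (π t) hB, ← hX.measure_inter_preimage hθ]
  congr 1
  ext ω
  refine and_congr_right fun hω => ?_
  simp [newCycles, hω t le_rfl]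

theorem IsCRP.measure_history_inter_newCycles (hX : IsCRP P θ n X) (hθ : 0 < θ) (t : ℕ) (ω : Ω)
    (B : Set ℝ) (hB : MeasurableSet B) :
    P (history X t ⁻¹' {history X t ω} ∩ newCycles X t ⁻¹' B) =
      P (history X t ⁻¹' {history X t ω}) * newCycleLaw θ (totalSize n t) (n (t + 1)) B := by
  have hatom : history X t ⁻¹' {history X t ω} = {ω' | ∀ s ≤ t, X s ω' = X s ω} := by
    ext ω'
    simp [history, funext_iff]
  rw [hatom, hX.measure_inter_preimage_newCycles hθ (fun s => X s ω) t hB]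

theorem IsCRP.hasLaw_newCycles (hX : IsCRP P θ n X) (hθ : 0 < θ) (t : ℕ) :
    HasLaw (newCycles X t) (newCycleLaw θ (totalSize n t) (n (t + 1))) P :=
  hasLaw_of_measure_inter_preimage_eq_mul (hX.measurable_history t) (hX.measurable_newCycles t)
    (hX.measure_history_inter_newCycles hθ t)

theorem IsCRP.indepFun_history_newCycles (hX : IsCRP P θ n X) (hθ : 0 < θ) (t : ℕ) :
    history X t ⟂ᵢ[P] newCycles X t :=
  indepFun_of_measure_inter_preimage_eq_mul (hX.measurable_history t) (hX.measurable_newCycles t)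
    (hX.measure_history_inter_newCycles hθ t)

theorem IsCRP.iIndepFun_newCycles (hX : IsCRP P θ n X) (hθ : 0 < θ) :
    iIndepFun (newCycles X) P := by
  refine iIndepFun_of_indepFun_Iio fun t => ?_
  exact (hX.indepFun_history_newCycles hθ t).comp
    (φ := fun h (i : Set.Iio t) => ((h ⟨i + 1, Set.mem_Iic.2 i.2⟩).numCycles : ℝ) -
      (h ⟨i, Set.mem_Iic.2 (Set.mem_Iio.1 i.2).le⟩).numCycles)
    .of_discrete measurable_id

end Chain

section CycleCount

open Asymptotics

variable {n : ℕ → ℕ} {θ : ℝ} {C : ℕ}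

theorem le_totalSize (hn : ∀ i ≥ 1, 1 ≤ n i) (t : ℕ) : t ≤ totalSize n t := by
  have hle := Finset.card_nsmul_le_sum (Finset.Icc 1 t) n 1 fun i hi =>
    hn i (Finset.mem_Icc.1 hi).1
  simpa [totalSize] using hle

theorem totalSize_le (hC : ∀ i ≥ 1, n i ≤ C) (t : ℕ) : totalSize n t ≤ t * C := by
  have hle := Finset.sum_le_card_nsmul (Finset.Icc 1 t) n C fun i hi =>
    hC i (Finset.mem_Icc.1 hi).1
  simpa [totalSize] using hle

theorem totalSize_of_forall_eq (hC : ∀ i ≥ 1, n i = C) (t : ℕ) : totalSize n t = t * C := by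
  rw [totalSize, Finset.sum_congr rfl fun i hi => hC i (Finset.mem_Icc.1 hi).1]
  simp

theorem div_mul_inv_le_mul_div_totalSize (hθ : 0 ≤ θ) (hn : ∀ i ≥ 1, 1 ≤ n i)
    (hC : ∀ i ≥ 1, n i ≤ C) (i : ℕ) :
    θ / C * (i : ℝ)⁻¹ ≤ θ * n (i + 1) / totalSize n i := by
  obtain rfl | hi := Nat.eq_zero_or_pos i
  · simp [totalSize]
  have hN : (0 : ℝ) < totalSize n i := by exact_mod_cast hi.trans_le (le_totalSize hn i)
  have hm : (1 : ℝ) ≤ n (i + 1) := by exact_mod_cast hn (i + 1) (by omega)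
  have hNC : (totalSize n i : ℝ) ≤ i * C := by exact_mod_cast totalSize_le hC i
  calc θ / C * (i : ℝ)⁻¹ = θ * 1 / (i * C) := by
        rw [mul_one, mul_comm (i : ℝ), ← div_div, div_eq_mul_inv (θ / C)]
    _ ≤ θ * n (i + 1) / totalSize n i := by gcongr

theorem mul_div_totalSize_le (hθ : 0 ≤ θ) (hn : ∀ i ≥ 1, 1 ≤ n i) (hC : ∀ i ≥ 1, n i ≤ C)
    (i : ℕ) : θ * n (i + 1) / totalSize n i ≤ θ * C * (i : ℝ)⁻¹ := by
  obtain rfl | hi := Nat.eq_zero_or_pos i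
  · simp [totalSize]
  have : (0 : ℝ) < i := by exact_mod_cast hi
  rw [← div_eq_mul_inv]
  gcongr
  · exact hC (i + 1) (by omega)
  · exact le_totalSize hn i

theorem isBigO_inv_sq_of_abs_le {w : ℕ → ℝ} {c : ℝ} (hc : 0 ≤ c) (hn : ∀ i ≥ 1, 1 ≤ n i)
    (hC : ∀ i ≥ 1, n i ≤ C)
    (hw : ∀ i ≥ 1, |w i| ≤ c * (n (i + 1) : ℝ) ^ 4 / (totalSize n i : ℝ) ^ 2) :
    w =O[atTop] fun i : ℕ => ((i : ℝ) ^ 2)⁻¹ := by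
  refine IsBigO.of_bound (c * (C : ℝ) ^ 4) (eventually_atTop.2 ⟨1, fun i hi => ?_⟩)
  have : (0 : ℝ) < i := by exact_mod_cast hi
  rw [Real.norm_eq_abs, Real.norm_of_nonneg (by positivity), ← div_eq_mul_inv]
  refine (hw i hi).trans ?_
  gcongr
  · exact hC (i + 1) (by omega)
  · exact le_totalSize hn i

theorem newCycleMean_sub_isBigO (hθ : 0 < θ) (hn : ∀ i ≥ 1, 1 ≤ n i) (hC : ∀ i ≥ 1, n i ≤ C) :
    (fun i => newCycleMean θ (totalSize n i) (n (i + 1)) - θ * n (i + 1) / totalSize n i)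
      =O[atTop] fun i : ℕ => ((i : ℝ) ^ 2)⁻¹ :=
  isBigO_inv_sq_of_abs_le (sq_nonneg (1 + 2 * θ)) hn hC fun i hi =>
    abs_newCycleMean_sub_le hθ _ (hi.trans (le_totalSize hn i))

theorem variance_newCycleLaw_sub_isBigO (hθ : 0 < θ) (hn : ∀ i ≥ 1, 1 ≤ n i)
    (hC : ∀ i ≥ 1, n i ≤ C) :
    (fun i => Var[id; newCycleLaw θ (totalSize n i) (n (i + 1))] -
      θ * n (i + 1) / totalSize n i) =O[atTop] fun i : ℕ => ((i : ℝ) ^ 2)⁻¹ :=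
  isBigO_inv_sq_of_abs_le (c := 2 * (1 + 2 * θ) ^ 2) (by positivity) hn hC fun i hi =>
    (abs_variance_newCycleLaw_sub_le hθ (hi.trans (le_totalSize hn i))).trans_eq (by ring)

theorem sum_range_sameOrder_log {u : ℕ → ℝ} (hθ : 0 < θ) (hn : ∀ i ≥ 1, 1 ≤ n i)
    (hC : ∀ i ≥ 1, n i ≤ C) (hu : ∀ i, 0 ≤ u i) (hu1 : 0 < u 1)
    (h : (fun i => u i - θ * n (i + 1) / totalSize n i) =O[atTop]
      fun i : ℕ => ((i : ℝ) ^ 2)⁻¹) :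
    SameOrder (fun t => ∑ i ∈ Finset.range t, u i) fun t => Real.log t := by
  have hC0 : (0 : ℝ) < C := by exact_mod_cast (hn 1 le_rfl).trans (hC 1 le_rfl)
  refine sameOrder_of_isTheta (fun t ht => ?_)
    (fun t ht => Real.log_pos (by exact_mod_cast ht))
    (sum_range_isTheta_log h (div_pos hθ hC0) (div_mul_inv_le_mul_div_totalSize hθ.le hn hC)
      (mul_div_totalSize_le hθ.le hn hC))
  exact Finset.sum_pos' (fun i _ => hu i) ⟨1, Finset.mem_range.2 ht, hu1⟩

theorem tendsto_sum_range_div_log_of_forall_eq {u : ℕ → ℝ} {m : ℕ} (hm : 1 ≤ m)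
    (hnm : ∀ i ≥ 1, n i = m)
    (h : (fun i => u i - θ * n (i + 1) / totalSize n i) =O[atTop]
      fun i : ℕ => ((i : ℝ) ^ 2)⁻¹) :
    Tendsto (fun t : ℕ => (∑ i ∈ Finset.range t, u i) / Real.log t) atTop (𝓝 θ) := by
  refine tendsto_sum_range_div_log (h.congr_left fun i => ?_)
  have hm' : (m : ℝ) ≠ 0 := Nat.cast_ne_zero.2 (Nat.one_le_iff_ne_zero.1 hm)
  rw [totalSize_of_forall_eq hnm, hnm (i + 1) (by omega), Nat.cast_mul,
    mul_div_mul_right _ _ hm', div_eq_mul_inv]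

variable {Ω : Type*} [MeasurableSpace Ω] {P : Measure Ω} [IsProbabilityMeasure P]
  {X : (t : ℕ) → Ω → MultisetPerm n t}

theorem IsCRP.ae_newCycles_mem_Icc (hX : IsCRP P θ n X) (hθ : 0 < θ) (t : ℕ) :
    ∀ᵐ ω ∂P, newCycles X t ω ∈ Set.Icc 0 (n (t + 1) : ℝ) := by
  have hlaw := ae_newCycleLaw_mem_Icc θ (totalSize n t) (n (t + 1))
  rw [← (hX.hasLaw_newCycles hθ t).map_eq] at hlaw
  exact ae_of_ae_map (hX.measurable_newCycles t).aemeasurable hlaw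

theorem IsCRP.memLp_newCycles (hX : IsCRP P θ n X) (hθ : 0 < θ) (t : ℕ) :
    MemLp (newCycles X t) 2 P :=
  memLp_of_mem_Icc (hX.measurable_newCycles t).aemeasurable (hX.ae_newCycles_mem_Icc hθ t) 2

theorem IsCRP.integral_sum_newCycles (hX : IsCRP P θ n X) (hθ : 0 < θ) (s : Finset ℕ) :
    ∫ ω, ∑ i ∈ s, newCycles X i ω ∂P =
      ∑ i ∈ s, newCycleMean θ (totalSize n i) (n (i + 1)) := by
  rw [integral_finsetSum _ fun i _ => (hX.memLp_newCycles hθ i).integrable one_le_two]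
  refine Finset.sum_congr rfl fun i _ => ?_
  rw [(hX.hasLaw_newCycles hθ i).integral_eq, integral_id_newCycleLaw hθ]

theorem IsCRP.variance_sum_newCycles (hX : IsCRP P θ n X) (hθ : 0 < θ) (s : Finset ℕ) :
    Var[fun ω => ∑ i ∈ s, newCycles X i ω; P] =
      ∑ i ∈ s, Var[id; newCycleLaw θ (totalSize n i) (n (i + 1))] := by
  rw [variance_sum_of_pairwise_indepFun
    (fun i j hij => (hX.iIndepFun_newCycles hθ).indepFun hij) (hX.memLp_newCycles hθ)]
  exact Finset.sum_congr rfl fun i _ => (hX.hasLaw_newCycles hθ i).variance_eq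

theorem IsCRP.tendsto_integral_and_variance_div_log (hX : IsCRP P θ n X) (hθ : 0 < θ) {m : ℕ}
    (hm : 1 ≤ m) (hnm : ∀ i ≥ 1, n i = m) :
    Tendsto (fun t : ℕ => (∫ ω, ∑ i ∈ Finset.range t, newCycles X i ω ∂P) / Real.log t)
        atTop (𝓝 θ) ∧
      Tendsto (fun t : ℕ => Var[fun ω => ∑ i ∈ Finset.range t, newCycles X i ω; P] / Real.log t)
        atTop (𝓝 θ) := by
  have hn : ∀ i ≥ 1, 1 ≤ n i := fun i hi => hm.trans_eq (hnm i hi).symm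
  have hC : ∀ i ≥ 1, n i ≤ m := fun i hi => (hnm i hi).le
  simp only [hX.integral_sum_newCycles hθ, hX.variance_sum_newCycles hθ]
  exact ⟨tendsto_sum_range_div_log_of_forall_eq hm hnm (newCycleMean_sub_isBigO hθ hn hC),
    tendsto_sum_range_div_log_of_forall_eq hm hnm (variance_newCycleLaw_sub_isBigO hθ hn hC)⟩

theorem IsCRP.sameOrder_integral_log (hX : IsCRP P θ n X) (hθ : 0 < θ)
    (hn : ∀ i ≥ 1, 1 ≤ n i) (hC : ∀ i ≥ 1, n i ≤ C) :
    SameOrder (fun t => ∫ ω, ∑ i ∈ Finset.range t, newCycles X i ω ∂P)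
      fun t => Real.log t := by
  simp only [hX.integral_sum_newCycles hθ]
  exact sum_range_sameOrder_log hθ hn hC (fun i => newCycleMean_nonneg hθ _ _)
    (newCycleMean_pos hθ (le_totalSize hn 1) (hn 2 (by omega))) (newCycleMean_sub_isBigO hθ hn hC)

theorem IsCRP.sameOrder_variance_log (hX : IsCRP P θ n X) (hθ : 0 < θ)
    (hn : ∀ i ≥ 1, 1 ≤ n i) (hC : ∀ i ≥ 1, n i ≤ C) :
    SameOrder (fun t => Var[fun ω => ∑ i ∈ Finset.range t, newCycles X i ω; P])
      fun t => Real.log t := by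
  simp only [hX.variance_sum_newCycles hθ]
  exact sum_range_sameOrder_log hθ hn hC (fun i => variance_nonneg _ _)
    (variance_newCycleLaw_pos hθ (le_totalSize hn 1) (hn 2 (by omega)))
    (variance_newCycleLaw_sub_isBigO hθ hn hC)

end CycleCount

end MultisetCRP

theorem theorem3_general {Ω : Type*} [MeasurableSpace Ω] (P : Measure Ω) [IsProbabilityMeasure P]
    (θ : ℝ) (hθ : 0 < θ) (n : ℕ → ℕ) (hn : ∀ i ≥ 1, 1 ≤ n i) (hbdd : ∃ C : ℕ, ∀ i ≥ 1, n i ≤ C)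
    (X : (t : ℕ) → Ω → MultisetCRP.MultisetPerm n t) (hX : MultisetCRP.IsCRP P θ n X)
    (K : ℕ → Ω → ℝ) (hK : ∀ t ω, K t ω = ((X t ω).numCycles : ℝ)) :
    ((∃ m : ℕ, ∀ i ≥ 1, n i = m) →
      Tendsto (fun t : ℕ => (∫ ω, K t ω ∂P) / Real.log t) atTop (𝓝 θ) ∧
      Tendsto (fun t : ℕ => variance (K t) P / Real.log t) atTop (𝓝 θ)) ∧
    MultisetCRP.SameOrder (fun t => ∫ ω, K t ω ∂P) (fun t => Real.log t) ∧
    MultisetCRP.SameOrder (fun t => variance (K t) P) (fun t => Real.log t) ∧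
    (∀ᵐ ω ∂P, Tendsto (fun t : ℕ => K t ω / ∫ ω', K t ω' ∂P) atTop (𝓝 1)) ∧
    TendstoInDistribution
      (fun (t : ℕ) (ω : Ω) => (K t ω - ∫ ω', K t ω' ∂P) / Real.sqrt (variance (K t) P))
      atTop (id : ℝ → ℝ) (fun _ => P) (gaussianReal 0 1) := by
  obtain ⟨C, hC⟩ := hbdd
  obtain rfl : K = fun t ω => ∑ i ∈ Finset.range t, MultisetCRP.newCycles X i ω :=
    funext₂ fun t ω => (hK t ω).trans (MultisetCRP.sum_range_newCycles X t ω).symm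
  have hindep := hX.iIndepFun_newCycles hθ
  have hmeas := fun i => (hX.measurable_newCycles i).aemeasurable (μ := P)
  have hbound : ∀ i, ∀ᵐ ω ∂P, MultisetCRP.newCycles X i ω ∈ Set.Icc 0 (C : ℝ) := fun i =>
    (hX.ae_newCycles_mem_Icc hθ i).mono fun ω hω =>
      ⟨hω.1, hω.2.trans (Nat.cast_le.2 (hC (i + 1) (by omega)))⟩
  have hmean := hX.sameOrder_integral_log hθ hn hC
  have hvar := hX.sameOrder_variance_log hθ hn hC
  refine ⟨?_, hmean, hvar, ?_, ?_⟩
  · rintro ⟨m, hm⟩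
    exact hX.tendsto_integral_and_variance_div_log hθ ((hn 1 le_rfl).trans_eq (hm 1 le_rfl)) hm
  · exact MultisetCRP.ae_tendsto_sum_div_integral (fun i j hij => hindep.indepFun hij) hmeas
      hbound (hmean.tendsto_atTop MultisetCRP.tendsto_log_natCast_atTop)
  · exact MultisetCRP.tendstoInDistribution_standardized_sum_sub_integral hindep hmeas
      (fun i => (hbound i).mono fun ω hω => (abs_of_nonneg hω.1).trans_le hω.2)
      (hvar.tendsto_atTop MultisetCRP.tendsto_log_natCast_atTop)

theorem theorem3 {Ω : Type*} [MeasurableSpace Ω] (P : Measure Ω) [IsProbabilityMeasure P]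
    (θ : ℝ) (hθ : 0 < θ) (n : ℕ → ℕ) (hn : ∀ i ≥ 1, 1 ≤ n i) (hbdd : ∃ C : ℕ, ∀ i ≥ 1, n i ≤ C)
    (X : (t : ℕ) → Ω → MultisetCRP.MultisetPerm n t) (hX : MultisetCRP.IsCRP P θ n X)
    (K : ℕ → Ω → ℝ) (hK : ∀ t ω, K t ω = ((X t ω).numCycles : ℝ)) :
    (θ = 1 → (∃ m : ℕ, ∀ i ≥ 1, n i = m) →
      Tendsto (fun t : ℕ => (∫ ω, K t ω ∂P) / Real.log t) atTop (𝓝 1) ∧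
      Tendsto (fun t : ℕ => variance (K t) P / Real.log t) atTop (𝓝 1)) ∧
    MultisetCRP.SameOrder (fun t => ∫ ω, K t ω ∂P) (fun t => Real.log t) ∧
    MultisetCRP.SameOrder (fun t => variance (K t) P) (fun t => Real.log t) ∧
    (∀ᵐ ω ∂P, Tendsto (fun t : ℕ => K t ω / ∫ ω', K t ω' ∂P) atTop (𝓝 1)) ∧
    TendstoInDistribution
      (fun (t : ℕ) (ω : Ω) => (K t ω - ∫ ω', K t ω' ∂P) / Real.sqrt (variance (K t) P))
      atTop (id : ℝ → ℝ) (fun _ => P) (gaussianReal 0 1) := by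
  obtain ⟨hconst, hrest⟩ := theorem3_general P θ hθ n hn hbdd X hX K hK
  exact ⟨by rintro rfl; exact hconst, hrest⟩
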